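/- For $\alpha>0$, $u_0\in L^2(0,1)$ and $f\in L^1_{loc}([0,\infty))$ (all real-valued) consider the heat system $$u_t(x,t)=\alpha u_{xx}(x,t)\ \ (0<x<1,\ t>0),\qquad \alpha u_x(0,t)=f(t),\quad u_x(1,t)=0,\qquad u(x,0)=u_0(x),$$ with boundary observation $y(t)=u(0,t)$. A solution is understood in the weak sense: $u\in L^1(0,T;W^{1,1}(0,1))$ for every $T>0$, and $$\int_0^\infty\!\!\int_0^1\bigl(\alpha u_x\varphi_x-u\varphi_t\bigr)\,dx\,dt-\int_0^1u_0(x)\varphi(x,0)\,dx+\int_0^\infty f(t)\varphi(0,t)\,dt=0$$ for all $\varphi\in C_c^\infty(\mathbb R^2)$; for almost every $t>0$, $u(0,t)$ is the boundary value at $x=0$ of the continuous representative of $u(\cdot,t)$ on $[0,1]$. Let $0\le T_1<T_2<T_3\le\infty$ and let the control $f$ satisfy $f(t)=0$ for $t\in[0,T_2)$ and $f(t)\neq0$ for almost all $t\in[T_2,T_3]$ (where $[T_2,T_3]$ means $[T_2,\infty)$ if $T_3=\infty$, and similarly for $[T_1,T_3]$). Then the observation $\{y(t)\mid t\in[T_1,T_3]\}$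 uniquely determines the diffusivity $\alpha$ and the initial state $u_0$: if $u$ and $u'$ are solutions with this same control $f$, with diffusivities $\alpha,\alpha'>0$ and initial states $u_0,u_0'\in L^2(0,1)$ respectively, and if $u(0,t)=u'(0,t)$ for almost every $t\in[T_1,T_3]$, then $\alpha=\alpha'$ and $u_0=u_0'$ in $L^2(0,1)$. No further condition (such as non-orthogonality to eigenfunctions) is imposed on $u_0$, $u_0'$. -/

import Mathlib

open MeasureTheory Set
open scoped ContDiff

/-- The state space `L²(0,1)` (real-valued). -/
abbrev StateSpace : Type := Lp ℝ 2 (volume.restrict (Ioo (0 : ℝ) 1))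

/-- `IsAntiderivOnUnit w v` says that `w` is absolutely continuous on `[0,1]` with derivative `v`,
i.e. `v ∈ L¹(0,1)` and `w` is the continuous representative, on `[0,1]`, of an element of
`W^{1,1}(0,1)` whose weak derivative is `v`. In particular `w 0` is the boundary value (trace) of
that element at the left end point. -/
def IsAntiderivOnUnit (w v : ℝ → ℝ) : Prop :=
  IntegrableOn v (Ioo 0 1) ∧ ∀ x ∈ Icc (0 : ℝ) 1, w x = w 0 + ∫ ξ in (0 : ℝ)..x, v ξ

/-- `IsHeatSolution α f u₀ u`: the function `u = u(x,t)` is a (weak) solution of the heat equation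
with Neumann boundary control
  `u_t = α u_xx` for `0 < x < 1`, `t > 0`,
  `α u_x(0,t) = f(t)`, `u_x(1,t) = 0` for `t > 0`,
  `u(x,0) = u₀(x)` for `0 < x < 1`.
It lies in `L¹(0,T; W^{1,1}(0,1))` for every `T > 0`, with weak space derivative `v = u_x`; for
almost every `t > 0` the profile `u(·,t)` is its continuous representative on `[0,1]`, so that
`u 0 t` is the boundary temperature. The equation, the boundary conditions and the initial
condition are expressed by multiplying with a test function `φ` and integrating by parts
once in `x` and once in `t`; `φ` is smooth with compact support in the plane and
is not required to vanish at `x = 0`, `x = 1` or `t = 0`. -/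
def IsHeatSolution (α : ℝ) (f : ℝ → ℝ) (u₀ : ℝ → ℝ) (u : ℝ → ℝ → ℝ) : Prop :=
  ∃ v : ℝ → ℝ → ℝ,
    (∀ T : ℝ, 0 < T → IntegrableOn (fun p : ℝ × ℝ => u p.1 p.2) (Ioo 0 1 ×ˢ Ioo 0 T)) ∧
    (∀ T : ℝ, 0 < T → IntegrableOn (fun p : ℝ × ℝ => v p.1 p.2) (Ioo 0 1 ×ˢ Ioo 0 T)) ∧
    (∀ᵐ t : ℝ, 0 < t → IsAntiderivOnUnit (fun x => u x t) (fun x => v x t)) ∧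
    ∀ φ : ℝ → ℝ → ℝ, ContDiff ℝ ∞ (fun p : ℝ × ℝ => φ p.1 p.2) →
      HasCompactSupport (fun p : ℝ × ℝ => φ p.1 p.2) →
      (∫ p : ℝ × ℝ in Ioo 0 1 ×ˢ Ioi 0,
          (α * v p.1 p.2 * deriv (fun x => φ x p.2) p.1
            - u p.1 p.2 * deriv (fun t => φ p.1 t) p.2))
        - (∫ x in Ioo (0 : ℝ) 1, u₀ x * φ x 0)
        + (∫ t in Ioi (0 : ℝ), f t * φ 0 t) = 0

/-! Write `c n = α(nπ)²` and `c' n = α'(nπ)²`. Testing the weak equation against `cos(nπx)η(t)`,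
with `cη - η' = g`, gives the cosine moments of the time average `∫ u(x,t) g(t) dt`. This average is
absolutely continuous in `x` and its moments are `O(n⁻²)`, so its cosine series may be evaluated at
`x = 0`. The result, `IsHeatSolution.hasSum_integral_trace_mul`, splits the observation tested
against `g` into a free part from `u₀` and a forced part from `f`.

Before `T₂` only the free part is seen. It is a Dirichlet series, holomorphic in the right half
plane, so agreement on `(T₁, T₂)` propagates to all later times (`IsHeatSolution.freeTrace_eq`).
Hence the forced parts agree as well, whatever the initial states are.

Test these with `g(s) = e^{-zs}` cut off after `b > T₂`. The `n`-th forced term is `F(z)/(z + c n)`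
up to `O(e^{-zb}/c n)`, where `F(z)` is the Laplace integral of `f` over `(T₂, b)`. So `F(z) ∑ κₙ
(1/(z + c n) - 1/(z + c' n)) = O(e^{-zb})`. If `α < α'`, every summand is nonnegative and the one
with `n = 1` is of order `z⁻²`, whence `e^{zb}|F(z)| = O((1+z)²)`
(`IsHeatSolution.abs_exp_moment_le`). Such growth forces `f = 0` a.e. on `(T₂, b)`
(`ae_eq_zero_of_exp_moment_le`), against the hypothesis on `f`. By symmetry `α = α'`.

With equal diffusivities the difference of the free responses is a vanishing Dirichlet series. Its
coefficients are zero (`eq_zero_of_freeTrace_eq_zero`), and cosine moments determine an integrable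
function (`ae_eq_zero_of_cosMoment_eq_zero`). No coefficient of `u₀` need be nonzero, because `α` is
read off from the forced part. -/

/-! ### Cosine moments on the unit interval -/

/-- The multiplicity of the eigenvalue `(nπ)²` in the two-sided cosine expansion. -/
noncomputable def cosWeight (n : ℕ) : ℝ := if n = 0 then 1 else 2

/-- The cosine moment `∫₀¹ w(x) cos(nπx) dx`. -/
noncomputable def cosMoment (w : ℝ → ℝ) (n : ℕ) : ℝ :=
  ∫ x in Ioo (0 : ℝ) 1, w x * Real.cos (n * Real.pi * x)

theorem cosWeight_nonneg (n : ℕ) : 0 ≤ cosWeight n := by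
  unfold cosWeight; split_ifs <;> norm_num

theorem cosWeight_le_two (n : ℕ) : cosWeight n ≤ 2 := by
  unfold cosWeight; split_ifs <;> norm_num

theorem cosWeight_pos (n : ℕ) : 0 < cosWeight n := by
  unfold cosWeight; split_ifs <;> norm_num

theorem MeasureTheory.IntegrableOn.mul_continuous_Ioo {w ψ : ℝ → ℝ}
    (hw : IntegrableOn w (Ioo 0 1)) (hψ : Continuous ψ) :
    IntegrableOn (fun x => w x * ψ x) (Ioo 0 1) := by
  obtain ⟨C, hC⟩ := isCompact_Icc.exists_bound_of_continuousOn (s := Icc (0 : ℝ) 1)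
    hψ.continuousOn
  exact Integrable.mul_bdd (c := C) hw hψ.aestronglyMeasurable
    ((ae_restrict_mem measurableSet_Ioo).mono fun x hx => hC x (Ioo_subset_Icc_self hx))

/-- The product-to-sum formula trades one factor `cos(πx)` for the frequencies `n ± 1`, so induction
on `k` works once `n` is left general. Powers of `cos(πx)` are what Weierstrass approximation needs.
-/
theorem integral_mul_cos_pow_mul_cos_eq_zero {w : ℝ → ℝ} (hw : IntegrableOn w (Ioo 0 1))
    (h : ∀ n, cosMoment w n = 0) (k n : ℕ) :
    ∫ x in Ioo (0 : ℝ) 1, w x * (Real.cos (Real.pi * x) ^ k * Real.cos (n * Real.pi * x)) = 0 := by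
  induction k generalizing n with
  | zero => simpa [cosMoment] using h n
  | succ k ih =>
    rcases n with _ | n
    · simpa [pow_succ] using ih 1
    · have e : ∀ x : ℝ, w x * (Real.cos (Real.pi * x) ^ (k + 1)
            * Real.cos ((n + 1 : ℕ) * Real.pi * x))
          = (1 / 2) * (w x * (Real.cos (Real.pi * x) ^ k * Real.cos ((n + 2 : ℕ) * Real.pi * x)))
          + (1 / 2) * (w x * (Real.cos (Real.pi * x) ^ k * Real.cos (n * Real.pi * x))) := by
        intro x
        have h1 : ((n + 2 : ℕ) : ℝ) * Real.pi * x
          = ((n + 1 : ℕ) : ℝ) * Real.pi * x + Real.pi * x := by push_cast; ring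
        have h2 : (n : ℝ) * Real.pi * x
          = ((n + 1 : ℕ) : ℝ) * Real.pi * x - Real.pi * x := by push_cast; ring
        rw [h1, h2, Real.cos_add, Real.cos_sub]; ring
      simp_rw [e]
      rw [integral_add, integral_const_mul, integral_const_mul, ih, ih]
      · simp
      all_goals
        refine Integrable.const_mul ?_ _
        exact hw.mul_continuous_Ioo (by fun_prop)

/-- A function in `L¹(0,1)` all of whose cosine moments vanish is zero almost everywhere. -/
theorem ae_eq_zero_of_cosMoment_eq_zero {w : ℝ → ℝ} (hw : IntegrableOn w (Ioo 0 1))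
    (h : ∀ n, cosMoment w n = 0) : ∀ᵐ x : ℝ, x ∈ Ioo (0 : ℝ) 1 → w x = 0 := by
  refine isOpen_Ioo.ae_eq_zero_of_integral_contDiff_smul_eq_zero hw.locallyIntegrableOn ?_
  intro g hg _ hgs
  have hpoly : ∀ p : Polynomial ℝ,
      ∫ x in Ioo (0 : ℝ) 1, w x * p.eval (Real.cos (Real.pi * x)) = 0 := by
    intro p
    induction p using Polynomial.induction_on' with
    | add p q hp hq =>
      simp only [Polynomial.eval_add, mul_add]
      rw [integral_add, hp, hq, add_zero]
      · exact hw.mul_continuous_Ioo (by fun_prop)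
      · exact hw.mul_continuous_Ioo (by fun_prop)
    | monomial n a =>
      have := integral_mul_cos_pow_mul_cos_eq_zero hw h n 0
      simp only [Nat.cast_zero, zero_mul, Real.cos_zero, mul_one] at this
      simp only [Polynomial.eval_monomial]
      calc _ = ∫ x in Ioo (0 : ℝ) 1, a * (w x * Real.cos (Real.pi * x) ^ n) := by
            congr 1; ext x; ring
        _ = 0 := by rw [integral_const_mul, this, mul_zero]
  have hset : ∫ x, g x • w x = ∫ x in Ioo (0 : ℝ) 1, w x * g x := by
    rw [setIntegral_eq_integral_of_forall_compl_eq_zero]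
    · simp [mul_comm]
    · intro x hx
      rw [image_eq_zero_of_notMem_tsupport (fun hh => hx (hgs hh)), mul_zero]
  rw [hset]
  by_contra hne
  set I := ∫ x in Ioo (0 : ℝ) 1, |w x|
  have hI0 : 0 ≤ I := integral_nonneg fun x => abs_nonneg _
  -- Dividing by `I + 1` keeps the tolerance `ε` meaningful when `I = 0` and yields `ε(I + 1) ≤ εI`,
  -- a contradiction.
  have hpos : 0 < |∫ x in Ioo (0 : ℝ) 1, w x * g x| / (I + 1) := by positivity
  -- Since `x ↦ cos(πx)` is a bijection from `[0,1]` onto `[-1,1]`, `g` is uniformly close to a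
  -- polynomial in `cos(πx)`.
  obtain ⟨p, hp⟩ := exists_polynomial_near_of_continuousOn (-1) 1
    (fun y => g (Real.arccos y / Real.pi))
    ((hg.continuous.comp (Real.continuous_arccos.div_const _)).continuousOn) _ hpos
  set ε := |∫ x in Ioo (0 : ℝ) 1, w x * g x| / (I + 1) with hε
  have hb : ∀ x ∈ Ioo (0 : ℝ) 1, |g x - p.eval (Real.cos (Real.pi * x))| ≤ ε := by
    intro x hx
    have := hp (Real.cos (Real.pi * x)) ⟨Real.neg_one_le_cos _, Real.cos_le_one _⟩
    rw [Real.arccos_cos (by have := hx.1; positivity)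
      (by nlinarith [hx.2, Real.pi_pos]), mul_div_cancel_left₀ _ Real.pi_ne_zero] at this
    rw [abs_sub_comm]; exact this.le
  have i1 : IntegrableOn (fun x => w x * g x) (Ioo 0 1) :=
    hw.mul_continuous_Ioo hg.continuous
  have i2 : IntegrableOn (fun x => w x * p.eval (Real.cos (Real.pi * x))) (Ioo 0 1) :=
    hw.mul_continuous_Ioo (by fun_prop)
  have key : |∫ x in Ioo (0 : ℝ) 1, w x * g x| ≤ ε * I := by
    calc |∫ x in Ioo (0 : ℝ) 1, w x * g x|
        = |∫ x in Ioo (0 : ℝ) 1, (w x * g x - w x * p.eval (Real.cos (Real.pi * x)))| := by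
          rw [integral_sub i1 i2, hpoly, sub_zero]
      _ ≤ ∫ x in Ioo (0 : ℝ) 1, ε * |w x| := by
          rw [← Real.norm_eq_abs]
          refine norm_integral_le_of_norm_le (hw.abs.const_mul ε) ?_
          filter_upwards [ae_restrict_mem measurableSet_Ioo] with x hx
          rw [← mul_sub, norm_mul, mul_comm, Real.norm_eq_abs, Real.norm_eq_abs]
          exact mul_le_mul_of_nonneg_right (hb x hx) (abs_nonneg _)
      _ = ε * I := by rw [integral_const_mul]
  have : |∫ x in Ioo (0 : ℝ) 1, w x * g x| = ε * (I + 1) := by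
    rw [hε]; field_simp
  nlinarith

theorem integral_cos_nat_mul_pi (n : ℕ) :
    ∫ x in Ioo (0 : ℝ) 1, Real.cos (n * Real.pi * x) = if n = 0 then 1 else 0 := by
  rw [← integral_Ioc_eq_integral_Ioo, ← intervalIntegral.integral_of_le zero_le_one]
  split_ifs with h
  · simp [h]
  · have hn : (n : ℝ) * Real.pi ≠ 0 := by
      have := Real.pi_ne_zero; positivity
    rw [intervalIntegral.integral_comp_mul_left (fun y => Real.cos y) hn]
    simp [Real.sin_nat_mul_pi]

theorem cosWeight_mul_integral_cos_mul_cos (n m : ℕ) :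
    cosWeight n * ∫ x in Ioo (0 : ℝ) 1, Real.cos (n * Real.pi * x) * Real.cos (m * Real.pi * x)
      = if n = m then 1 else 0 := by
  wlog hle : m ≤ n generalizing n m
  · have := this m n (by omega)
    have hne : n ≠ m := by omega
    rw [if_neg hne.symm] at this
    rw [if_neg hne]
    have h2 := (mul_eq_zero.1 this).resolve_left (cosWeight_pos m).ne'
    simp_rw [mul_comm (Real.cos (n * Real.pi * _))]
    rw [h2, mul_zero]
  have e : ∀ x : ℝ, Real.cos (n * Real.pi * x) * Real.cos (m * Real.pi * x)
      = (1 / 2) * Real.cos ((n - m : ℕ) * Real.pi * x)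
        + (1 / 2) * Real.cos ((n + m : ℕ) * Real.pi * x) := by
    intro x
    have h1 : ((n - m : ℕ) : ℝ) * Real.pi * x = n * Real.pi * x - m * Real.pi * x := by
      push_cast [hle]; ring
    have h2 : ((n + m : ℕ) : ℝ) * Real.pi * x = n * Real.pi * x + m * Real.pi * x := by
      push_cast; ring
    rw [h1, h2, Real.cos_sub, Real.cos_add]; ring
  have hint : ∀ k : ℕ, IntegrableOn (fun x : ℝ => (1 / 2) * Real.cos (k * Real.pi * x))
      (Ioo 0 1) := fun k =>
    (Continuous.integrableOn_Icc (by fun_prop)).mono_set Ioo_subset_Icc_self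
  simp_rw [e]
  rw [integral_add (hint _) (hint _), integral_const_mul, integral_const_mul,
    integral_cos_nat_mul_pi, integral_cos_nat_mul_pi]
  unfold cosWeight
  by_cases hnm : n = m
  · subst hnm
    by_cases h0 : n = 0 <;> simp [h0]; norm_num
  · have h1 : n - m ≠ 0 := by omega
    have h2 : n + m ≠ 0 := by omega
    simp only [h1, h2, hnm, if_false]; norm_num

/-- The cosine series of a continuous function with summable cosine moments converges to the
function at `0`. -/
theorem hasSum_cosMoment_of_summable {W : ℝ → ℝ} (hW : ContinuousOn W (Icc 0 1))
    (hs : Summable fun n => |cosMoment W n|) :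
    HasSum (fun n => cosWeight n * cosMoment W n) (W 0) := by
  have hsum : Summable fun n => 2 * |cosMoment W n| := hs.mul_left 2
  have hbd : ∀ n (x : ℝ), ‖cosWeight n * cosMoment W n * Real.cos (n * Real.pi * x)‖
      ≤ 2 * |cosMoment W n| := by
    intro n x
    rw [norm_mul, norm_mul, Real.norm_eq_abs, Real.norm_eq_abs, Real.norm_eq_abs,
      abs_of_nonneg (cosWeight_nonneg n)]
    calc _ ≤ 2 * |cosMoment W n| * 1 := by
          gcongr
          · exact cosWeight_le_two n
          · exact Real.abs_cos_le_one _
      _ = _ := mul_one _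
  set S : ℝ → ℝ := fun x => ∑' n, cosWeight n * cosMoment W n * Real.cos (n * Real.pi * x)
  have hS : Continuous S := continuous_tsum (fun n => by fun_prop) hsum hbd
  have hWi : IntegrableOn W (Ioo 0 1) :=
    (hW.integrableOn_Icc).mono_set Ioo_subset_Icc_self
  have hSi : IntegrableOn S (Ioo 0 1) :=
    (hS.integrableOn_Icc).mono_set Ioo_subset_Icc_self
  have hcoef : ∀ m, cosMoment S m = cosMoment W m := by
    intro m
    have h1 : HasSum (fun n => ∫ x in Ioo (0 : ℝ) 1,
        cosWeight n * cosMoment W n * Real.cos (n * Real.pi * x) * Real.cos (m * Real.pi * x))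
        (∫ x in Ioo (0 : ℝ) 1, S x * Real.cos (m * Real.pi * x)) := by
      refine hasSum_integral_of_dominated_convergence (fun n _ => 2 * |cosMoment W n|)
        (fun n => Continuous.aestronglyMeasurable (by fun_prop)) ?_ ?_ ?_ ?_
      · refine fun n => Filter.Eventually.of_forall fun x => ?_
        rw [norm_mul]
        calc _ ≤ 2 * |cosMoment W n| * 1 := by
              gcongr
              · exact hbd n x
              · exact Real.abs_cos_le_one _
          _ = _ := mul_one _
      · exact Filter.Eventually.of_forall fun x => hsum
      · exact integrable_const _
      · exact Filter.Eventually.of_forall fun x =>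
          ((hsum.of_norm_bounded (hbd · x)).hasSum).mul_right _
    have h2 : (fun n => ∫ x in Ioo (0 : ℝ) 1,
        cosWeight n * cosMoment W n * Real.cos (n * Real.pi * x) * Real.cos (m * Real.pi * x))
        = fun n => if n = m then cosMoment W m else 0 := by
      ext n
      calc _ = ∫ x in Ioo (0 : ℝ) 1, cosMoment W n * (cosWeight n *
              (Real.cos (n * Real.pi * x) * Real.cos (m * Real.pi * x))) := by
            congr 1; ext x; ring
        _ = cosMoment W n * (cosWeight n * ∫ x in Ioo (0 : ℝ) 1,
              Real.cos (n * Real.pi * x) * Real.cos (m * Real.pi * x)) := by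
            rw [integral_const_mul, integral_const_mul]
        _ = _ := by
            rw [cosWeight_mul_integral_cos_mul_cos]
            split_ifs with h <;> simp [h]
    rw [h2] at h1
    exact h1.unique (hasSum_ite_eq m _)
  -- Equal moments give equality only a.e.; continuity of both sides then extends it to the end
  -- point `0`.
  have hae : ∀ᵐ x : ℝ, x ∈ Ioo (0 : ℝ) 1 → (W - S) x = 0 := by
    refine ae_eq_zero_of_cosMoment_eq_zero (hWi.sub hSi) fun n => ?_
    have := hcoef n
    unfold cosMoment at this ⊢
    simp only [Pi.sub_apply, sub_mul]
    rw [integral_sub (hWi.mul_continuous_Ioo (by fun_prop))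
      (hSi.mul_continuous_Ioo (by fun_prop)), this, sub_self]
  have heq : EqOn W S (Icc 0 1) := by
    refine Measure.eqOn_Icc_of_ae_eq volume zero_ne_one ?_ hW hS.continuousOn
    rw [Filter.EventuallyEq, ← restrict_Ioo_eq_restrict_Icc,
      ae_restrict_iff' measurableSet_Ioo]
    filter_upwards [hae] with x hx hx'
    exact sub_eq_zero.1 (hx hx')
  have h0 := heq (left_mem_Icc.2 zero_le_one)
  rw [h0]
  have h1 := (hsum.of_norm_bounded (hbd · 0)).hasSum
  simp only [mul_zero, Real.cos_zero, mul_one] at h1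
  simpa only [S, mul_zero, Real.cos_zero, mul_one] using h1

/-! ### Exponential moments and vanishing -/

theorem hasSum_pow_succ_div_factorial (y : ℝ) :
    HasSum (fun k : ℕ => y ^ (k + 1) / ((k + 1).factorial : ℝ)) (Real.exp y - 1) := by
  have h1 : HasSum (fun k : ℕ => y ^ k / (k.factorial : ℝ)) (Real.exp y) := by
    have := NormedSpace.expSeries_div_hasSum_exp y
    rwa [← Real.exp_eq_exp_ℝ] at this
  rw [← hasSum_nat_add_iff' 1] at h1
  simpa using h1

/-- Expanding `exp(-y) - 1` in powers of `y = e^{n(b-t-x)}` turns the integral into a series of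
moments of order `(k+1)n`, weighted by `e^{-(k+1)nx}`. The moment bound leaves the factor
`e^{-(k+1)nx/2}`, and these terms resum to an exponential. -/
theorem abs_integral_mul_exp_neg_exp_sub_one_le {f : ℝ → ℝ} {a b x C : ℝ}
    (hf : IntegrableOn f (Ioo a b))
    (hC : ∀ k : ℕ, 1 ≤ k →
      |∫ t in Ioo a b, f t * Real.exp (k * (b - t))| ≤ C * Real.exp (k * x / 2))
    {n : ℕ} (hn : 1 ≤ n) :
    |∫ t in Ioo a b, f t * (Real.exp (-Real.exp (n * (b - t - x))) - 1)|
      ≤ C * (Real.exp (Real.exp (-(n * x / 2))) - 1) := by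
  have hpow : ∀ (k : ℕ) (t : ℝ), (-Real.exp (n * (b - t - x))) ^ (k + 1)
      = (-1) ^ (k + 1) * Real.exp (-(((k + 1) * n : ℕ) * x))
        * Real.exp (((k + 1) * n : ℕ) * (b - t)) := by
    intro k t
    rw [neg_pow, ← Real.exp_nat_mul, mul_assoc, ← Real.exp_add]
    congr 2
    push_cast; ring
  have hsum : HasSum (fun k : ℕ => ∫ t in Ioo a b,
      f t * ((-Real.exp (n * (b - t - x))) ^ (k + 1) / ((k + 1).factorial : ℝ)))
      (∫ t in Ioo a b, f t * (Real.exp (-Real.exp (n * (b - t - x))) - 1)) := by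
    refine hasSum_integral_of_dominated_convergence
      (fun k t => |f t| * (Real.exp (n * (b - a - x)) ^ (k + 1) / ((k + 1).factorial : ℝ)))
      (fun k => hf.aestronglyMeasurable.mul (Continuous.aestronglyMeasurable (by fun_prop)))
      ?_ ?_ ?_ ?_
    · intro k
      filter_upwards [ae_restrict_mem measurableSet_Ioo] with t ht
      rw [norm_mul, norm_div, norm_pow, norm_neg, Real.norm_eq_abs, Real.norm_eq_abs,
        Real.norm_eq_abs, Real.abs_exp, Nat.abs_cast]
      gcongr
      exact ht.1.le
    · exact Filter.Eventually.of_forall fun t =>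
        ((hasSum_pow_succ_div_factorial _).summable).mul_left _
    · simp_rw [tsum_mul_left]
      exact hf.abs.mul_const _
    · exact Filter.Eventually.of_forall fun t => (hasSum_pow_succ_div_factorial _).mul_left _
  have hmaj := (hasSum_pow_succ_div_factorial (Real.exp (-(n * x / 2)))).mul_left C
  rw [← hsum.tsum_eq, ← hmaj.tsum_eq, ← Real.norm_eq_abs]
  refine tsum_of_norm_bounded hmaj.summable.hasSum fun k => ?_
  have e : ∫ t in Ioo a b,
      f t * ((-Real.exp (n * (b - t - x))) ^ (k + 1) / ((k + 1).factorial : ℝ))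
      = ((-1) ^ (k + 1) * Real.exp (-(((k + 1) * n : ℕ) * x)) / ((k + 1).factorial : ℝ))
        * ∫ t in Ioo a b, f t * Real.exp (((k + 1) * n : ℕ) * (b - t)) := by
    rw [← integral_const_mul]
    congr 1; ext t
    rw [hpow]; ring
  rw [e, norm_mul, norm_div, norm_mul, norm_pow, norm_neg, norm_one, one_pow, one_mul,
    Real.norm_eq_abs, Real.norm_eq_abs, Real.norm_eq_abs, Real.abs_exp, Nat.abs_cast]
  calc _ ≤ Real.exp (-(((k + 1) * n : ℕ) * x)) / ((k + 1).factorial : ℝ)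
        * (C * Real.exp (((k + 1) * n : ℕ) * x / 2)) := by
        gcongr
        exact hC _ (Nat.mul_pos k.succ_pos hn)
    _ = C * ((Real.exp (-(((k + 1) * n : ℕ) * x)) * Real.exp (((k + 1) * n : ℕ) * x / 2))
        / ((k + 1).factorial : ℝ)) := by ring
    _ = _ := by
        rw [← Real.exp_add, ← Real.exp_nat_mul]
        congr 3
        push_cast; ring

/-- As `n → ∞` the kernel `exp(-e^{n(b-t-x)}) - 1` tends to `-1` for `t < b - x` and to `0` for `t >
b - x`, so the integrals converge to minus the integral wanted. The preceding bound makes the same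
limit zero. -/
theorem setIntegral_eq_zero_of_exp_moment_le {f : ℝ → ℝ} {a b x C : ℝ} (hx : 0 < x)
    (hf : IntegrableOn f (Ioo a b))
    (hC : ∀ k : ℕ, 1 ≤ k →
      |∫ t in Ioo a b, f t * Real.exp (k * (b - t))| ≤ C * Real.exp (k * x / 2)) :
    ∫ t in Ioo a (b - x), f t = 0 := by
  have hcast : Filter.Tendsto (fun n : ℕ => (n : ℝ)) Filter.atTop Filter.atTop :=
    tendsto_natCast_atTop_atTop
  have hlim0 : Filter.Tendsto (fun n : ℕ =>
      ∫ t in Ioo a b, f t * (Real.exp (-Real.exp (n * (b - t - x))) - 1))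
      Filter.atTop (nhds 0) := by
    have h1 : Filter.Tendsto (fun n : ℕ => C * (Real.exp (Real.exp (-(n * x / 2))) - 1))
        Filter.atTop (nhds 0) := by
      have h2 : Filter.Tendsto (fun n : ℕ => Real.exp (-((n : ℝ) * x / 2)))
          Filter.atTop (nhds 0) := by
        refine Real.tendsto_exp_neg_atTop_nhds_zero.comp ?_
        simp_rw [mul_div_assoc]
        exact hcast.atTop_mul_const (by positivity)
      have h3 := (((Real.continuous_exp.tendsto 0).comp h2).sub_const 1).const_mul C
      simpa using h3
    refine squeeze_zero_norm' ?_ h1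
    filter_upwards [Filter.eventually_ge_atTop 1] with n hn
    exact abs_integral_mul_exp_neg_exp_sub_one_le hf hC hn
  have hlim1 : Filter.Tendsto (fun n : ℕ =>
      ∫ t in Ioo a b, f t * (Real.exp (-Real.exp (n * (b - t - x))) - 1))
      Filter.atTop (nhds (∫ t in Ioo a b, (Iio (b - x)).indicator (fun t => - f t) t)) := by
    refine tendsto_integral_of_dominated_convergence (fun t => |f t|)
      (fun n => hf.aestronglyMeasurable.mul (Continuous.aestronglyMeasurable (by fun_prop)))
      hf.abs ?_ ?_
    · refine fun n => Filter.Eventually.of_forall fun t => ?_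
      rw [norm_mul]
      refine mul_le_of_le_one_right (norm_nonneg _) ?_
      rw [Real.norm_eq_abs, abs_le]
      constructor
      · linarith [Real.exp_pos (-Real.exp (n * (b - t - x)))]
      · have : Real.exp (-Real.exp (n * (b - t - x))) ≤ 1 := by
          rw [Real.exp_le_one_iff]; linarith [Real.exp_pos (n * (b - t - x))]
        linarith
    · have hne : ∀ᵐ t : ℝ ∂(volume.restrict (Ioo a b)), t ≠ b - x :=
        ae_restrict_of_ae (Measure.ae_ne volume _)
      filter_upwards [hne] with t ht
      rcases lt_or_gt_of_ne ht with h | h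
      · rw [indicator_of_mem (mem_Iio.2 h)]
        have h1 : Filter.Tendsto (fun n : ℕ => Real.exp ((n : ℝ) * (b - t - x)))
            Filter.atTop Filter.atTop :=
          Real.tendsto_exp_atTop.comp (hcast.atTop_mul_const (by linarith))
        have h2 := ((Real.tendsto_exp_neg_atTop_nhds_zero.comp h1).sub_const 1).const_mul (f t)
        simpa using h2
      · rw [indicator_of_notMem (by simpa using h.le)]
        have h1 : Filter.Tendsto (fun n : ℕ => Real.exp ((n : ℝ) * (b - t - x)))
            Filter.atTop (nhds 0) :=
          Real.tendsto_exp_atBot.comp (hcast.atTop_mul_const_of_neg (by linarith))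
        have h2 := (((Real.continuous_exp.tendsto _).comp h1.neg).sub_const 1).const_mul (f t)
        simpa using h2
  have := tendsto_nhds_unique hlim1 hlim0
  rw [setIntegral_indicator measurableSet_Iio, Ioo_inter_Iio, min_eq_right (by linarith),
    integral_neg, neg_eq_zero] at this
  exact this

/-- An integrable function on `(a,b)` whose exponential moments towards `b` grow at most
quadratically vanishes almost everywhere. -/
theorem ae_eq_zero_of_exp_moment_le {f : ℝ → ℝ} {a b : ℝ} (hf : IntegrableOn f (Ioo a b))
    {C : ℝ}
    (hC : ∀ z : ℝ, 1 ≤ z → |∫ t in Ioo a b, f t * Real.exp (z * (b - t))| ≤ C * (1 + z) ^ 2) :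
    ∀ᵐ t : ℝ, t ∈ Ioo a b → f t = 0 := by
  rcases le_or_gt b a with hab | hab
  · simp [Ioo_eq_empty_of_le hab]
  have hC0 : 0 ≤ C := by
    have := (abs_nonneg _).trans (hC 1 le_rfl)
    norm_num at this; linarith
  have hzero : ∀ c ∈ Ioo a b, ∫ t in a..c, f t = 0 := by
    intro c hc
    rw [intervalIntegral.integral_of_le hc.1.le, integral_Ioc_eq_integral_Ioo]
    set x := b - c with hx
    have hx0 : 0 < x := by linarith [hc.2]
    have hcx : c = b - x := by ring
    rw [hcx]
    -- With `p = 2/x` and `y = kx/2` one has `k = py`, and the constant comes from `(1 + py)² ≤ (1 +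
    -- 2p + 2p²)(1 + y + y²/2)`, where the last factor is at most `e^y`.
    refine setIntegral_eq_zero_of_exp_moment_le (C := C * (1 + 2 * (2 / x) + 2 * (2 / x) ^ 2))
      hx0 hf fun k hk => ?_
    refine (hC k (by exact_mod_cast hk)).trans ?_
    rw [mul_assoc]
    refine mul_le_mul_of_nonneg_left ?_ hC0
    set y : ℝ := k * x / 2 with hy
    have hy0 : 0 ≤ y := by positivity
    have hk' : (k : ℝ) = 2 / x * y := by rw [hy]; field_simp
    have hp : 0 < 2 / x := by positivity
    have hexp := Real.quadratic_le_exp_of_nonneg hy0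
    refine le_trans ?_ (mul_le_mul_of_nonneg_left hexp (by positivity))
    rw [hk']
    set p := 2 / x
    have : 0 ≤ p * y ^ 2 := by positivity
    have : 0 ≤ p ^ 2 * y := by positivity
    nlinarith [sq_nonneg y]
  have hint : IntervalIntegrable f volume a b := by
    rwa [intervalIntegrable_iff_integrableOn_Ioo_of_le hab.le]
  filter_upwards [hint.ae_hasDerivAt_integral] with t ht htm
  have h1 := ht (by rw [uIcc_of_le hab.le]; exact Ioo_subset_Icc_self htm) a (by simp)
  have h2 : HasDerivAt (fun x => ∫ v in a..x, f v) 0 t :=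
    (hasDerivAt_const t (0 : ℝ)).congr_of_eventuallyEq <| by
      filter_upwards [Ioo_mem_nhds htm.1 htm.2] with c hc using hzero c hc
  exact h1.unique h2

/-! ### The backward modal equation -/

/-- The decaying solution `η(t) = ∫ₜ^∞ e^{-c(s-t)} g(s) ds` of `c η - η' = g`. -/
noncomputable def backwardSol (c : ℝ) (g : ℝ → ℝ) (t : ℝ) : ℝ :=
  ∫ s in Ioi t, Real.exp (-c * (s - t)) * g s

theorem exp_neg_mul_sub (c s t : ℝ) :
    Real.exp (-c * (s - t)) = Real.exp (c * t) * Real.exp (-c * s) := by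
  rw [← Real.exp_add]; congr 1; ring

theorem integrableOn_exp_neg_mul_sub {c : ℝ} (hc : 0 < c) (t : ℝ) :
    IntegrableOn (fun s => Real.exp (-c * (s - t))) (Ioi t) := by
  simp_rw [exp_neg_mul_sub]
  exact (integrableOn_exp_mul_Ioi (by linarith) t).const_mul _

theorem integral_exp_neg_mul_sub {c : ℝ} (hc : 0 < c) (t : ℝ) :
    ∫ s in Ioi t, Real.exp (-c * (s - t)) = 1 / c := by
  simp_rw [exp_neg_mul_sub]
  rw [integral_const_mul, integral_exp_mul_Ioi (by linarith) t, neg_div_neg_eq, ← mul_div_assoc,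
    ← Real.exp_add]
  simp

theorem abs_setIntegral_exp_mul_le {c M : ℝ} (hc : 0 < c) {g : ℝ → ℝ} {t : ℝ}
    (hM : ∀ s, t < s → |g s| ≤ M) :
    |∫ s in Ioi t, Real.exp (-c * (s - t)) * g s| ≤ M / c := by
  calc |∫ s in Ioi t, Real.exp (-c * (s - t)) * g s|
      ≤ ∫ s in Ioi t, Real.exp (-c * (s - t)) * M := by
        rw [← Real.norm_eq_abs]
        refine norm_integral_le_of_norm_le ((integrableOn_exp_neg_mul_sub hc t).mul_const M) ?_
        filter_upwards [ae_restrict_mem measurableSet_Ioi] with s hs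
        rw [norm_mul, Real.norm_eq_abs, Real.norm_eq_abs, Real.abs_exp]
        gcongr
        exact hM s hs
    _ = M / c := by rw [integral_mul_const, integral_exp_neg_mul_sub hc]; ring

theorem abs_backwardSol_le {c M : ℝ} (hc : 0 < c) {g : ℝ → ℝ} {t : ℝ}
    (hM : ∀ s, t < s → |g s| ≤ M) : |backwardSol c g t| ≤ M / c :=
  abs_setIntegral_exp_mul_le hc hM

theorem backwardSol_eq_zero {c B : ℝ} {g : ℝ → ℝ} (hB : ∀ s, B ≤ s → g s = 0) {t : ℝ}
    (ht : B ≤ t) : backwardSol c g t = 0 := by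
  refine setIntegral_eq_zero_of_forall_eq_zero fun s hs => ?_
  rw [hB s (ht.trans (le_of_lt hs)), mul_zero]

theorem backwardSol_eq_intervalIntegral {c B : ℝ} {g : ℝ → ℝ} (hB : ∀ s, B ≤ s → g s = 0)
    (t : ℝ) : backwardSol c g t = Real.exp (c * t) * ∫ s in t..B, Real.exp (-c * s) * g s := by
  rcases le_total t B with h | h
  · rw [intervalIntegral.integral_of_le h, ← integral_const_mul, backwardSol]
    simp_rw [exp_neg_mul_sub, mul_assoc]
    refine setIntegral_eq_of_subset_of_forall_sdiff_eq_zero measurableSet_Ioi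
      Ioc_subset_Ioi_self fun s hs => ?_
    have : B ≤ s := by
      by_contra hlt
      exact hs.2 ⟨hs.1, (not_le.1 hlt).le⟩
    simp [hB s this]
  · rw [backwardSol_eq_zero hB h, intervalIntegral.integral_zero_ae, mul_zero]
    refine Filter.Eventually.of_forall fun s hs => ?_
    rw [uIoc_of_ge h] at hs
    rw [hB s hs.1.le, mul_zero]

theorem hasDerivAt_backwardSol {c B : ℝ} {g : ℝ → ℝ} (hg : Continuous g)
    (hB : ∀ s, B ≤ s → g s = 0) (t : ℝ) :
    HasDerivAt (backwardSol c g) (c * backwardSol c g t - g t) t := by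
  have hcont : Continuous fun s => Real.exp (-c * s) * g s := by fun_prop
  have h1 : HasDerivAt (fun t => ∫ s in t..B, Real.exp (-c * s) * g s)
      (-(Real.exp (-c * t) * g t)) t :=
    intervalIntegral.integral_hasDerivAt_left (hcont.intervalIntegrable _ _)
      (hcont.stronglyMeasurableAtFilter _ _) hcont.continuousAt
  have h2 : HasDerivAt (fun t => Real.exp (c * t)) (Real.exp (c * t) * (c * 1)) t :=
    ((hasDerivAt_id' t).const_mul c).exp
  have h3 : HasDerivAt (fun t => Real.exp (c * t) * ∫ s in t..B, Real.exp (-c * s) * g s) _ t :=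
    h2.mul h1
  have e : backwardSol c g
      = fun t => Real.exp (c * t) * ∫ s in t..B, Real.exp (-c * s) * g s :=
    funext fun t => backwardSol_eq_intervalIntegral hB t
  rw [e]
  convert h3 using 1
  have : Real.exp (c * t) * Real.exp (-c * t) = 1 := by
    rw [← Real.exp_add]; simp
  linear_combination (g t) * this

theorem contDiff_backwardSol {c B : ℝ} {g : ℝ → ℝ} (hg : ContDiff ℝ ∞ g)
    (hB : ∀ s, B ≤ s → g s = 0) : ContDiff ℝ ∞ (backwardSol c g) := by
  have hd : ∀ t, HasDerivAt (backwardSol c g) (c * backwardSol c g t - g t) t :=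
    hasDerivAt_backwardSol hg.continuous hB
  have hder : deriv (backwardSol c g) = fun t => c * backwardSol c g t - g t :=
    funext fun t => (hd t).deriv
  rw [contDiff_infty]
  intro n
  induction n with
  | zero =>
    exact contDiff_zero.2 (continuous_iff_continuousAt.2 fun t => (hd t).continuousAt)
  | succ n ih =>
    rw [Nat.cast_succ, contDiff_succ_iff_deriv]
    refine ⟨fun t => (hd t).differentiableAt, by simp, ?_⟩
    rw [hder]
    exact (contDiff_const.mul ih).sub (contDiff_infty.1 hg n)

/-- The backward solution vanishes for large times but need not for very negative ones. A cutoff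
equal to `1` on `[-1, ∞)` makes it an admissible test function without affecting `t ≥ 0`. -/
theorem exists_testFunction_eq_backwardSol {c B : ℝ} {g : ℝ → ℝ} (hg : ContDiff ℝ ∞ g)
    (hB : ∀ s, B ≤ s → g s = 0) :
    ∃ η : ℝ → ℝ, ContDiff ℝ ∞ η ∧ HasCompactSupport η ∧
      (∀ t, 0 ≤ t → η t = backwardSol c g t) ∧
      ∀ t, 0 ≤ t → deriv η t = c * η t - g t := by
  have hev : ∀ t : ℝ, -1 ≤ t → Real.smoothTransition (t + 2) * backwardSol c g t
      = backwardSol c g t := fun t ht => by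
    rw [Real.smoothTransition.one_of_one_le (by linarith), one_mul]
  refine ⟨fun t => Real.smoothTransition (t + 2) * backwardSol c g t, ?_, ?_, ?_, ?_⟩
  · exact (Real.smoothTransition.contDiff.comp (contDiff_id.add contDiff_const)).mul
      (contDiff_backwardSol hg hB)
  · refine HasCompactSupport.of_support_subset_isCompact (isCompact_Icc (a := -2) (b := B)) ?_
    intro t ht
    rw [Function.mem_support] at ht
    constructor
    · by_contra h
      exact ht (by rw [Real.smoothTransition.zero_of_nonpos (by linarith), zero_mul])
    · by_contra h
      exact ht (by rw [backwardSol_eq_zero hB (by linarith), mul_zero])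
  · exact fun t ht => hev t (by linarith)
  · intro t ht
    have h1 : (fun t => Real.smoothTransition (t + 2) * backwardSol c g t)
        =ᶠ[nhds t] backwardSol c g := by
      filter_upwards [Ioi_mem_nhds (show -1 < t by linarith)] with s hs using hev s (le_of_lt hs)
    rw [h1.deriv_eq, (hasDerivAt_backwardSol hg.continuous hB t).deriv]
    simp only [hev t (by linarith)]

/-! ### Spatial profiles and their time averages -/

/-- Integration by parts on `[0,1]` for an absolutely continuous profile. -/
theorem IsAntiderivOnUnit.integral_mul {w v : ℝ → ℝ} (h : IsAntiderivOnUnit w v) {ψ ψ' : ℝ → ℝ}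
    (hψ : ∀ x, HasDerivAt ψ (ψ' x) x) (hψ' : Continuous ψ') :
    ∫ x in Ioo (0 : ℝ) 1, v x * ψ x
      = w 1 * ψ 1 - w 0 * ψ 0 - ∫ x in Ioo (0 : ℝ) 1, w x * ψ' x := by
  have hvi : IntervalIntegrable v volume 0 1 := by
    rw [intervalIntegrable_iff_integrableOn_Ioo_of_le zero_le_one]; exact h.1
  have hder : deriv ψ = ψ' := funext fun x => (hψ x).deriv
  have hψ1 : ContDiff ℝ 1 ψ := contDiff_one_iff_deriv.2
    ⟨fun x => (hψ x).differentiableAt, by rwa [hder]⟩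
  have hac : AbsolutelyContinuousOnInterval (fun x => ∫ ξ in (0 : ℝ)..x, v ξ) 0 1 :=
    hvi.absolutelyContinuousOnInterval_intervalIntegral (by simp)
  have hacψ : AbsolutelyContinuousOnInterval ψ 0 1 := hψ1.contDiffOn.absolutelyContinuousOnInterval
  have hibp := hac.integral_mul_deriv_eq_deriv_mul hacψ
  have h1 : ∫ x in (0 : ℝ)..1, deriv (fun x => ∫ ξ in (0 : ℝ)..x, v ξ) x * ψ x
      = ∫ x in (0 : ℝ)..1, v x * ψ x := by
    refine intervalIntegral.integral_congr_ae ?_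
    filter_upwards [hvi.ae_hasDerivAt_integral] with x hx hxm
    rw [(hx (uIoc_subset_uIcc hxm) 0 (by simp)).deriv]
  rw [h1, hder] at hibp
  have hw1 := h.2 1 (by simp)
  have hGi : IntervalIntegrable (fun x => (∫ ξ in (0 : ℝ)..x, v ξ) * ψ' x) volume 0 1 :=
    (hac.continuousOn.mul hψ'.continuousOn).intervalIntegrable
  have hψi : ∫ x in (0 : ℝ)..1, ψ' x = ψ 1 - ψ 0 :=
    intervalIntegral.integral_eq_sub_of_hasDerivAt (fun x _ => hψ x)
      (hψ'.intervalIntegrable _ _)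
  have h2 : ∫ x in Ioo (0 : ℝ) 1, w x * ψ' x
      = w 0 * (ψ 1 - ψ 0) + ∫ x in (0 : ℝ)..1, (∫ ξ in (0 : ℝ)..x, v ξ) * ψ' x := by
    rw [← hψi, ← intervalIntegral.integral_const_mul,
      ← intervalIntegral.integral_add ((hψ'.intervalIntegrable _ _).const_mul _) hGi,
      intervalIntegral.integral_of_le zero_le_one, integral_Ioc_eq_integral_Ioo]
    refine setIntegral_congr_fun measurableSet_Ioo fun x hx => ?_
    rw [h.2 x (Ioo_subset_Icc_self hx)]; ring
  rw [h2, hw1, ← integral_Ioc_eq_integral_Ioo, ← intervalIntegral.integral_of_le zero_le_one]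
  simp only [intervalIntegral.integral_same, zero_mul, sub_zero] at hibp
  linarith

theorem IsAntiderivOnUnit.continuousOn {w v : ℝ → ℝ} (h : IsAntiderivOnUnit w v) :
    ContinuousOn w (Icc 0 1) := by
  have hvi : IntervalIntegrable v volume 0 1 := by
    rw [intervalIntegrable_iff_integrableOn_Ioo_of_le zero_le_one]; exact h.1
  have hac : AbsolutelyContinuousOnInterval (fun x => ∫ ξ in (0 : ℝ)..x, v ξ) 0 1 :=
    hvi.absolutelyContinuousOnInterval_intervalIntegral (by simp)
  have hc := hac.continuousOn
  rw [uIcc_of_le zero_le_one] at hc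
  exact (continuousOn_const.add hc).congr h.2

/-- The factor `sin(nπx)` vanishes at both end points, so no boundary term appears when integrating
by parts. -/
theorem IsAntiderivOnUnit.cosMoment_eq {w v : ℝ → ℝ} (h : IsAntiderivOnUnit w v) (n : ℕ) :
    (n * Real.pi) ^ 2 * cosMoment w n
      = ∫ x in Ioo (0 : ℝ) 1, v x * -(n * Real.pi * Real.sin (n * Real.pi * x)) := by
  have hψ : ∀ x : ℝ, HasDerivAt (fun x => -(n * Real.pi * Real.sin (n * Real.pi * x)))
      (-(n * Real.pi * (Real.cos (n * Real.pi * x) * (n * Real.pi * 1)))) x := fun x =>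
    ((((hasDerivAt_id x).const_mul (n * Real.pi)).sin).const_mul (n * Real.pi)).neg
  rw [h.integral_mul hψ (by fun_prop), cosMoment, ← integral_const_mul]
  simp only [mul_one, Real.sin_nat_mul_pi, mul_zero, Real.sin_zero, neg_zero, sub_zero, zero_sub]
  rw [← integral_neg]
  congr 1; ext x; ring

/-- Integration by parts against `x - 1`, which vanishes at `1`. Writing the trace through integrals
over the interval is what makes it integrable in time. -/
theorem IsAntiderivOnUnit.apply_zero {w v : ℝ → ℝ} (h : IsAntiderivOnUnit w v) :
    w 0 = (∫ x in Ioo (0 : ℝ) 1, w x) + ∫ x in Ioo (0 : ℝ) 1, v x * (x - 1) := by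
  rw [h.integral_mul (fun x => (hasDerivAt_id' x).sub_const 1) continuous_const]
  simp

theorem integrable_slab_mul {u : ℝ → ℝ → ℝ}
    (hu : ∀ T : ℝ, 0 < T → IntegrableOn (fun p : ℝ × ℝ => u p.1 p.2) (Ioo 0 1 ×ˢ Ioo 0 T))
    {g : ℝ → ℝ} (hg : Continuous g) (hgs : HasCompactSupport g)
    {ψ : ℝ → ℝ} (hψ : Continuous ψ) :
    Integrable (fun p : ℝ × ℝ => u p.1 p.2 * ψ p.1 * g p.2)
      ((volume.restrict (Ioo (0 : ℝ) 1)).prod (volume.restrict (Ioi (0 : ℝ)))) := by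
  obtain ⟨B, hB⟩ := hgs.isCompact.bddAbove
  set T := max B 0 + 1
  have hT0 : 0 < T := by positivity
  obtain ⟨C, hC⟩ := (isCompact_Icc.prod isCompact_Icc).exists_bound_of_continuousOn
    (s := Icc (0 : ℝ) 1 ×ˢ Icc (0 : ℝ) T) (f := fun p : ℝ × ℝ => ψ p.1 * g p.2)
    (by fun_prop)
  rw [Measure.prod_restrict, ← Measure.volume_eq_prod]
  have h1 : IntegrableOn (fun p : ℝ × ℝ => u p.1 p.2 * (ψ p.1 * g p.2))
      (Ioo 0 1 ×ˢ Ioo 0 T) := by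
    refine Integrable.mul_bdd (c := C) (hu T hT0) (Continuous.aestronglyMeasurable (by fun_prop)) ?_
    filter_upwards [ae_restrict_mem (measurableSet_Ioo.prod measurableSet_Ioo)] with p hp
    exact hC p ⟨Ioo_subset_Icc_self hp.1, Ioo_subset_Icc_self hp.2⟩
  have h2 : IntegrableOn (fun p : ℝ × ℝ => u p.1 p.2 * (ψ p.1 * g p.2))
      (Ioo 0 1 ×ˢ Ioi 0) := by
    refine h1.of_forall_sdiff_eq_zero (measurableSet_Ioo.prod measurableSet_Ioi) ?_
    intro p hp
    have hpT : T ≤ p.2 := by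
      by_contra hlt
      exact hp.2 ⟨hp.1.1, hp.1.2, not_le.1 hlt⟩
    have : g p.2 = 0 := image_eq_zero_of_notMem_tsupport fun hm => by
      have := hB hm
      have := le_max_left B 0
      linarith
    simp [this]
  simp only [mul_assoc]
  exact h2

/-- Fubini allows the profile identity, valid for almost every `t`, to be averaged in time. The
averaged profile is continuous up to `0`, where its value is the observation tested against `g`. -/
theorem isAntiderivOnUnit_integral_time {u v : ℝ → ℝ → ℝ}
    (hu : ∀ T : ℝ, 0 < T → IntegrableOn (fun p : ℝ × ℝ => u p.1 p.2) (Ioo 0 1 ×ˢ Ioo 0 T))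
    (hv : ∀ T : ℝ, 0 < T → IntegrableOn (fun p : ℝ × ℝ => v p.1 p.2) (Ioo 0 1 ×ˢ Ioo 0 T))
    (huv : ∀ᵐ t : ℝ, 0 < t → IsAntiderivOnUnit (fun x => u x t) (fun x => v x t))
    {g : ℝ → ℝ} (hg : Continuous g) (hgs : HasCompactSupport g) :
    IsAntiderivOnUnit (fun x => ∫ t in Ioi (0 : ℝ), u x t * g t)
      (fun x => ∫ t in Ioi (0 : ℝ), v x t * g t) := by
  have hug := integrable_slab_mul hu hg hgs (continuous_const (y := (1 : ℝ)))
  have hvg := integrable_slab_mul hv hg hgs (continuous_const (y := (1 : ℝ)))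
  have hvx := integrable_slab_mul hv hg hgs (show Continuous fun x : ℝ => x - 1 by fun_prop)
  simp only [mul_one] at hug hvg
  have huv' : ∀ᵐ t : ℝ ∂(volume.restrict (Ioi 0)),
      IsAntiderivOnUnit (fun x => u x t) (fun x => v x t) := by
    rw [ae_restrict_iff' measurableSet_Ioi]; exact huv
  have hy : Integrable (fun t => u 0 t * g t) (volume.restrict (Ioi (0 : ℝ))) := by
    refine (hug.integral_prod_right.add hvx.integral_prod_right).congr ?_
    filter_upwards [huv'] with t ht
    simp only [Pi.add_apply]
    rw [integral_mul_const, integral_mul_const, ← add_mul, ← ht.apply_zero]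
  refine ⟨hvg.integral_prod_left, fun x hx => ?_⟩
  have hvgx : Integrable (fun p : ℝ × ℝ => v p.1 p.2 * g p.2)
      ((volume.restrict (Ioo (0 : ℝ) x)).prod (volume.restrict (Ioi (0 : ℝ)))) :=
    hvg.mono_measure (Measure.prod_mono
      (Measure.restrict_mono (Ioo_subset_Ioo_right hx.2) le_rfl) le_rfl)
  have h1 : ∫ t in Ioi (0 : ℝ), u x t * g t
      = ∫ t in Ioi (0 : ℝ), (u 0 t * g t + ∫ ξ in Ioo (0 : ℝ) x, v ξ t * g t) := by
    refine integral_congr_ae ?_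
    filter_upwards [huv'] with t ht
    have := ht.2 x hx
    simp only at this
    rw [this, intervalIntegral.integral_of_le hx.1, integral_Ioc_eq_integral_Ioo,
      integral_mul_const, add_mul]
  beta_reduce
  rw [h1, integral_add hy hvgx.integral_prod_right, intervalIntegral.integral_of_le hx.1,
    integral_Ioc_eq_integral_Ioo]
  congr 1
  exact (integral_integral_swap hvgx).symm

theorem integral_mul_integral_time {u : ℝ → ℝ → ℝ}
    (hu : ∀ T : ℝ, 0 < T → IntegrableOn (fun p : ℝ × ℝ => u p.1 p.2) (Ioo 0 1 ×ˢ Ioo 0 T))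
    {g : ℝ → ℝ} (hg : Continuous g) (hgs : HasCompactSupport g)
    {ψ : ℝ → ℝ} (hψ : Continuous ψ) :
    ∫ x in Ioo (0 : ℝ) 1, (∫ t in Ioi (0 : ℝ), u x t * g t) * ψ x
      = ∫ p : ℝ × ℝ in Ioo 0 1 ×ˢ Ioi 0, u p.1 p.2 * ψ p.1 * g p.2 := by
  have h := integrable_slab_mul hu hg hgs hψ
  rw [Measure.volume_eq_prod, ← Measure.prod_restrict, integral_prod _ h]
  congr 1; ext x
  rw [← integral_mul_const]
  congr 1; ext t; ring

/-! ### Modal expansion of the observation -/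

/-- A smooth cutoff equal to `1` on `[-1,2]` and supported in `[-2,3]`. -/
noncomputable def unitCutoff (x : ℝ) : ℝ :=
  Real.smoothTransition (x + 2) * Real.smoothTransition (3 - x)

theorem contDiff_unitCutoff : ContDiff ℝ ∞ unitCutoff :=
  (Real.smoothTransition.contDiff.comp (contDiff_id.add contDiff_const)).mul
    (Real.smoothTransition.contDiff.comp (contDiff_const.sub contDiff_id))

theorem unitCutoff_eq_one {x : ℝ} (h : x ∈ Icc (-1 : ℝ) 2) : unitCutoff x = 1 := by
  unfold unitCutoff
  rw [Real.smoothTransition.one_of_one_le (by linarith [h.1]),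
    Real.smoothTransition.one_of_one_le (by linarith [h.2]), one_mul]

theorem unitCutoff_eq_zero {x : ℝ} (h : x ∉ Icc (-2 : ℝ) 3) : unitCutoff x = 0 := by
  unfold unitCutoff
  rw [mem_Icc, not_and_or, not_le, not_le] at h
  rcases h with h | h
  · rw [Real.smoothTransition.zero_of_nonpos (by linarith), zero_mul]
  · rw [Real.smoothTransition.zero_of_nonpos (x := 3 - x) (by linarith), mul_zero]

/-- The weak formulation tested against `cos(nπx) η(t)`. -/
theorem cosMoment_weak_formulation {α : ℝ} {f u₀ : ℝ → ℝ} {u v : ℝ → ℝ → ℝ}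
    (hu : ∀ T : ℝ, 0 < T → IntegrableOn (fun p : ℝ × ℝ => u p.1 p.2) (Ioo 0 1 ×ˢ Ioo 0 T))
    (hv : ∀ T : ℝ, 0 < T → IntegrableOn (fun p : ℝ × ℝ => v p.1 p.2) (Ioo 0 1 ×ˢ Ioo 0 T))
    (huv : ∀ᵐ t : ℝ, 0 < t → IsAntiderivOnUnit (fun x => u x t) (fun x => v x t))
    (hweak : ∀ φ : ℝ → ℝ → ℝ, ContDiff ℝ ∞ (fun p : ℝ × ℝ => φ p.1 p.2) →
      HasCompactSupport (fun p : ℝ × ℝ => φ p.1 p.2) →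
      (∫ p : ℝ × ℝ in Ioo 0 1 ×ˢ Ioi 0,
          (α * v p.1 p.2 * deriv (fun x => φ x p.2) p.1
            - u p.1 p.2 * deriv (fun t => φ p.1 t) p.2))
        - (∫ x in Ioo (0 : ℝ) 1, u₀ x * φ x 0)
        + (∫ t in Ioi (0 : ℝ), f t * φ 0 t) = 0)
    {η : ℝ → ℝ} (hη : ContDiff ℝ ∞ η) (hηs : HasCompactSupport η) (n : ℕ) :
    α * (n * Real.pi) ^ 2 * cosMoment (fun x => ∫ t in Ioi (0 : ℝ), u x t * η t) n
      - cosMoment (fun x => ∫ t in Ioi (0 : ℝ), u x t * deriv η t) n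
      = cosMoment u₀ n * η 0 - ∫ t in Ioi (0 : ℝ), f t * η t := by
  have hη'c : Continuous (deriv η) := (contDiff_infty_iff_deriv.1 hη).2.continuous
  set ψ : ℝ → ℝ := fun x => -(n * Real.pi * Real.sin (n * Real.pi * x)) with hψ
  have hψc : Continuous ψ := by fun_prop
  have hcosd : ∀ x : ℝ, HasDerivAt (fun x : ℝ => Real.cos (n * Real.pi * x)) (ψ x) x := fun x => by
    convert ((hasDerivAt_id' x).const_mul (n * Real.pi)).cos using 1
    simp only [hψ]; ring
  have h := hweak (fun x t => unitCutoff x * Real.cos (n * Real.pi * x) * η t) ?_ ?_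
  · have e1 : ∫ p : ℝ × ℝ in Ioo 0 1 ×ˢ Ioi 0,
        (α * v p.1 p.2 * deriv (fun x => unitCutoff x * Real.cos (n * Real.pi * x) * η p.2) p.1
          - u p.1 p.2
            * deriv (fun t => unitCutoff p.1 * Real.cos (n * Real.pi * p.1) * η t) p.2)
        = ∫ p : ℝ × ℝ in Ioo 0 1 ×ˢ Ioi 0,
          (α * (v p.1 p.2 * ψ p.1 * η p.2)
            - u p.1 p.2 * Real.cos (n * Real.pi * p.1) * deriv η p.2) := by
      refine setIntegral_congr_fun (measurableSet_Ioo.prod measurableSet_Ioi) fun p hp => ?_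
      have hx := hp.1
      have hev : (fun x => unitCutoff x * Real.cos (n * Real.pi * x) * η p.2)
          =ᶠ[nhds p.1] fun x => Real.cos (n * Real.pi * x) * η p.2 := by
        filter_upwards [Ioo_mem_nhds hx.1 hx.2] with x hx'
        rw [unitCutoff_eq_one ⟨by linarith [hx'.1], by linarith [hx'.2]⟩, one_mul]
      have hd1 : deriv (fun x => unitCutoff x * Real.cos (n * Real.pi * x) * η p.2) p.1
          = ψ p.1 * η p.2 := by
        rw [hev.deriv_eq, ((hcosd p.1).mul_const (η p.2)).deriv]
      have hd2 : deriv (fun t => unitCutoff p.1 * Real.cos (n * Real.pi * p.1) * η t) p.2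
          = Real.cos (n * Real.pi * p.1) * deriv η p.2 := by
        rw [deriv_const_mul_field,
          unitCutoff_eq_one ⟨by linarith [hx.1], by linarith [hx.2]⟩, one_mul]
      simp only [hd1, hd2]
      ring
    have i1 := (integrable_slab_mul hv hη.continuous hηs hψc).const_mul α
    have i2 := integrable_slab_mul hu hη'c hηs.deriv
      (show Continuous fun x : ℝ => Real.cos (n * Real.pi * x) by fun_prop)
    rw [Measure.prod_restrict, ← Measure.volume_eq_prod] at i1 i2
    have e2 : ∫ x in Ioo (0 : ℝ) 1, u₀ x * (unitCutoff x * Real.cos (n * Real.pi * x) * η 0)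
        = cosMoment u₀ n * η 0 := by
      rw [cosMoment, ← integral_mul_const]
      refine setIntegral_congr_fun measurableSet_Ioo fun x hx => ?_
      simp only [unitCutoff_eq_one ⟨show -1 ≤ x by linarith [hx.1], show x ≤ 2 by linarith [hx.2]⟩]
      ring
    have e3 : unitCutoff 0 * Real.cos (n * Real.pi * 0) = 1 := by
      rw [unitCutoff_eq_one (by norm_num)]; simp
    rw [e1, integral_sub i1 i2, integral_const_mul, e2] at h
    simp only [e3, one_mul] at h
    have hW := isAntiderivOnUnit_integral_time hu hv huv hη.continuous hηs
    rw [mul_assoc, hW.cosMoment_eq, integral_mul_integral_time hv hη.continuous hηs hψc, cosMoment,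
      integral_mul_integral_time hu hη'c hηs.deriv (by fun_prop)]
    linarith
  · refine ContDiff.mul (ContDiff.mul (contDiff_unitCutoff.comp contDiff_fst) ?_)
      (hη.comp contDiff_snd)
    exact Real.contDiff_cos.comp (contDiff_const.mul contDiff_fst)
  · refine HasCompactSupport.of_support_subset_isCompact
      ((isCompact_Icc (a := (-2 : ℝ)) (b := 3)).prod hηs.isCompact) ?_
    intro p hp
    rw [Function.mem_support] at hp
    constructor
    · by_contra hx
      exact hp (by simp [unitCutoff_eq_zero hx])
    · by_contra ht
      exact hp (by simp [image_eq_zero_of_notMem_tsupport ht])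

theorem abs_setIntegral_mul_le {f k : ℝ → ℝ} {B m : ℝ} (hf : LocallyIntegrableOn f (Ici 0))
    (hk : ∀ t, 0 < t → |k t| ≤ m) (hB : ∀ t, B ≤ t → k t = 0) :
    |∫ t in Ioi (0 : ℝ), f t * k t| ≤ m * ∫ t in Ioo (0 : ℝ) B, |f t| := by
  have hfi : IntegrableOn f (Ioo 0 B) :=
    (hf.integrableOn_compact_subset Icc_subset_Ici_self isCompact_Icc).mono_set
      (Ioo_subset_Icc_self (b := B))
  have h1 : ∫ t in Ioi (0 : ℝ), f t * k t = ∫ t in Ioo (0 : ℝ) B, f t * k t := by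
    refine setIntegral_eq_of_subset_of_forall_sdiff_eq_zero measurableSet_Ioi
      (fun t ht => ht.1) fun t ht => ?_
    rw [hB t (by by_contra hlt; exact ht.2 ⟨ht.1, not_le.1 hlt⟩), mul_zero]
  rw [h1, ← Real.norm_eq_abs, ← integral_const_mul]
  refine norm_integral_le_of_norm_le (hfi.abs.const_mul m) ?_
  filter_upwards [ae_restrict_mem measurableSet_Ioo] with t ht
  rw [norm_mul, Real.norm_eq_abs, Real.norm_eq_abs, mul_comm]
  exact mul_le_mul_of_nonneg_right (hk t ht.1) (abs_nonneg _)

theorem abs_cosMoment_le {w : ℝ → ℝ} (hw : IntegrableOn w (Ioo 0 1)) (n : ℕ) :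
    |cosMoment w n| ≤ ∫ x in Ioo (0 : ℝ) 1, |w x| := by
  rw [cosMoment, ← Real.norm_eq_abs]
  refine norm_integral_le_of_norm_le hw.abs (Filter.Eventually.of_forall fun x => ?_)
  rw [norm_mul]
  exact mul_le_of_le_one_right (norm_nonneg _) (Real.abs_cos_le_one _)

/-- Modal expansion of the boundary observation of a weak solution, tested against `g`. -/
theorem IsHeatSolution.hasSum_integral_trace_mul {α : ℝ} (hα : 0 < α) {f u₀ : ℝ → ℝ}
    {u : ℝ → ℝ → ℝ} (h : IsHeatSolution α f u₀ u) (hu₀ : IntegrableOn u₀ (Ioo 0 1))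
    (hf : LocallyIntegrableOn f (Ici 0)) {g : ℝ → ℝ} (hg : ContDiff ℝ ∞ g)
    (hgs : HasCompactSupport g) :
    HasSum (fun n : ℕ => cosWeight n *
      (cosMoment u₀ n * backwardSol (α * (n * Real.pi) ^ 2) g 0
        - ∫ t in Ioi (0 : ℝ), f t * backwardSol (α * (n * Real.pi) ^ 2) g t))
      (∫ t in Ioi (0 : ℝ), u 0 t * g t) := by
  obtain ⟨v, hu, hv, huv, hweak⟩ := h
  obtain ⟨B', hB'⟩ := hgs.isCompact.bddAbove
  have hB : ∀ s, B' + 1 ≤ s → g s = 0 := fun s hs =>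
    image_eq_zero_of_notMem_tsupport fun hm => by linarith [hB' hm]
  obtain ⟨M, hM⟩ := hgs.exists_bound_of_continuous hg.continuous
  have hW := isAntiderivOnUnit_integral_time hu hv huv hg.continuous hgs
  have hmom : ∀ n : ℕ, cosMoment (fun x => ∫ t in Ioi (0 : ℝ), u x t * g t) n
      = cosMoment u₀ n * backwardSol (α * (n * Real.pi) ^ 2) g 0
        - ∫ t in Ioi (0 : ℝ), f t * backwardSol (α * (n * Real.pi) ^ 2) g t := by
    intro n
    set c := α * (n * Real.pi) ^ 2 with hc
    -- Since `cη - η' = g` for `t ≥ 0`, the left side of the weak formulation collapses to the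
    -- moment of the `g`-average.
    obtain ⟨η, hη, hηs, hη1, hη2⟩ := exists_testFunction_eq_backwardSol (c := c) hg hB
    have hw := cosMoment_weak_formulation hu hv huv hweak hη hηs n
    have hη'c : Continuous (deriv η) := (contDiff_infty_iff_deriv.1 hη).2.continuous
    have hcos : Continuous fun x : ℝ => Real.cos (n * Real.pi * x) := by fun_prop
    have e1 : ∫ t in Ioi (0 : ℝ), f t * η t = ∫ t in Ioi (0 : ℝ), f t * backwardSol c g t :=
      setIntegral_congr_fun measurableSet_Ioi fun t ht => by
        simp only [hη1 t (le_of_lt ht)]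
    rw [hη1 0 le_rfl, e1] at hw
    rw [← hw]
    unfold cosMoment
    rw [integral_mul_integral_time hu hg.continuous hgs hcos,
      integral_mul_integral_time hu hη.continuous hηs hcos,
      integral_mul_integral_time hu hη'c hηs.deriv hcos, ← integral_const_mul]
    have i1 := (integrable_slab_mul hu hη.continuous hηs hcos).const_mul c
    have i2 := integrable_slab_mul hu hη'c hηs.deriv hcos
    rw [Measure.prod_restrict, ← Measure.volume_eq_prod] at i1 i2
    rw [← integral_sub i1 i2]
    refine setIntegral_congr_fun (measurableSet_Ioo.prod measurableSet_Ioi) fun p hp => ?_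
    simp only [hη2 p.2 (le_of_lt hp.2)]
    ring
  simp_rw [← hmom]
  refine hasSum_cosMoment_of_summable hW.continuousOn ?_
  -- The backward solution is at most `M/(α(nπ)²)`, which supplies the `n⁻²` decay of both the free
  -- and the forced term.
  set K := ((∫ x in Ioo (0 : ℝ) 1, |u₀ x|) * M + M * ∫ t in Ioo (0 : ℝ) (B' + 1), |f t|)
    / (α * Real.pi ^ 2) with hK
  have hsum : Summable fun n : ℕ => K * (1 / (n : ℝ) ^ 2) :=
    (Real.summable_one_div_nat_pow.2 one_lt_two).mul_left K
  refine Summable.of_norm_bounded_eventually_nat hsum ?_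
  filter_upwards [Filter.eventually_ge_atTop 1] with n hn
  have hn0 : (0 : ℝ) < n := by exact_mod_cast hn
  have hc : 0 < α * (n * Real.pi) ^ 2 := by have := Real.pi_pos; positivity
  have hJ : ∀ t, |backwardSol (α * (n * Real.pi) ^ 2) g t| ≤ M / (α * (n * Real.pi) ^ 2) :=
    fun t => abs_backwardSol_le hc fun s _ => hM s
  rw [hmom, Real.norm_eq_abs, abs_abs]
  calc _ ≤ |cosMoment u₀ n * backwardSol (α * (n * Real.pi) ^ 2) g 0|
        + |∫ t in Ioi (0 : ℝ), f t * backwardSol (α * (n * Real.pi) ^ 2) g t| := abs_sub _ _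
    _ ≤ (∫ x in Ioo (0 : ℝ) 1, |u₀ x|) * (M / (α * (n * Real.pi) ^ 2))
        + M / (α * (n * Real.pi) ^ 2) * ∫ t in Ioo (0 : ℝ) (B' + 1), |f t| := by
        refine add_le_add ?_ (abs_setIntegral_mul_le hf (fun t _ => hJ t)
          fun t ht => backwardSol_eq_zero hB ht)
        rw [abs_mul]
        exact mul_le_mul (abs_cosMoment_le hu₀ n) (hJ 0) (abs_nonneg _)
          (integral_nonneg fun x => abs_nonneg _)
    _ = K * (1 / (n : ℝ) ^ 2) := by
        rw [hK]
        have := Real.pi_ne_zero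
        field_simp

/-! ### The free response as a Dirichlet series -/

/-- The free boundary response `s ↦ ∑ κₙ aₙ e^{-α(nπ)²s}` with initial cosine moments `a`. -/
noncomputable def freeTrace (α : ℝ) (a : ℕ → ℝ) (s : ℝ) : ℝ :=
  ∑' n : ℕ, cosWeight n * a n * Real.exp (-(α * (n * Real.pi) ^ 2) * s)

/-- The holomorphic extension of `freeTrace` to the right half plane. -/
noncomputable def freeTraceComplex (α : ℝ) (a : ℕ → ℝ) (z : ℂ) : ℂ :=
  ∑' n : ℕ, ((cosWeight n * a n : ℝ) : ℂ) * Complex.exp (((-(α * (n * Real.pi) ^ 2) : ℝ) : ℂ) * z)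

theorem ofReal_freeTrace (α : ℝ) (a : ℕ → ℝ) (s : ℝ) :
    ((freeTrace α a s : ℝ) : ℂ) = freeTraceComplex α a s := by
  rw [freeTrace, freeTraceComplex, Complex.ofReal_tsum]
  congr 1; ext n
  simp only [Complex.ofReal_mul, Complex.ofReal_exp]

/-- From `n ≤ n²` the series has a geometric majorant, uniform on `[s₀, ∞)`. -/
theorem exp_neg_sq_mul_le {α s₀ s : ℝ} (hα : 0 < α) (hs₀ : 0 < s₀) (hs : s₀ ≤ s) (n : ℕ) :
    Real.exp (-(α * (n * Real.pi) ^ 2) * s) ≤ Real.exp (-(α * Real.pi ^ 2 * s₀)) ^ n := by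
  rw [← Real.exp_nat_mul, Real.exp_le_exp]
  have h1 : (n : ℝ) ≤ (n : ℝ) ^ 2 := by exact_mod_cast Nat.le_self_pow two_ne_zero n
  have h2 : 0 ≤ α * Real.pi ^ 2 := by positivity
  have h3 : (n : ℝ) * s₀ ≤ (n : ℝ) ^ 2 * s := by gcongr
  nlinarith [mul_le_mul_of_nonneg_left h3 h2]

theorem summable_exp_pow {α s₀ A : ℝ} (hα : 0 < α) (hs₀ : 0 < s₀) :
    Summable fun n : ℕ => 2 * A * Real.exp (-(α * Real.pi ^ 2 * s₀)) ^ n := by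
  refine (summable_geometric_of_lt_one (Real.exp_pos _).le ?_).mul_left _
  rw [Real.exp_lt_one_iff]
  have := Real.pi_pos
  have : 0 < α * Real.pi ^ 2 * s₀ := by positivity
  linarith

theorem abs_freeTrace_term_le {α s₀ s A : ℝ} (hα : 0 < α) (hs₀ : 0 < s₀) (hs : s₀ ≤ s)
    {a : ℕ → ℝ} (ha : ∀ n, |a n| ≤ A) (n : ℕ) :
    |cosWeight n * a n * Real.exp (-(α * (n * Real.pi) ^ 2) * s)|
      ≤ 2 * A * Real.exp (-(α * Real.pi ^ 2 * s₀)) ^ n := by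
  rw [abs_mul, abs_mul, Real.abs_exp, abs_of_nonneg (cosWeight_nonneg n)]
  have hA : 0 ≤ A := (abs_nonneg _).trans (ha 0)
  gcongr
  · exact cosWeight_le_two n
  · exact ha n
  · exact exp_neg_sq_mul_le hα hs₀ hs n

theorem differentiableOn_freeTraceComplex {α p A : ℝ} (hα : 0 < α) (hp : 0 < p)
    {a : ℕ → ℝ} (ha : ∀ n, |a n| ≤ A) :
    DifferentiableOn ℂ (freeTraceComplex α a) {z : ℂ | p < z.re} := by
  refine Complex.differentiableOn_tsum_of_summable_norm (summable_exp_pow (A := A) hα hp)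
    (fun n => Differentiable.differentiableOn (by fun_prop))
    (isOpen_lt continuous_const Complex.continuous_re) fun n z hz => ?_
  have := abs_freeTrace_term_le hα hp (le_of_lt hz) ha n
  rw [norm_mul, Complex.norm_exp, Complex.re_ofReal_mul, Complex.norm_real, Real.norm_eq_abs]
  rwa [abs_mul _ (Real.exp _), Real.abs_exp] at this

theorem continuousOn_freeTrace {α p A : ℝ} (hα : 0 < α) (hp : 0 < p)
    {a : ℕ → ℝ} (ha : ∀ n, |a n| ≤ A) : ContinuousOn (freeTrace α a) (Ioi p) := by
  have h1 : ContinuousOn (fun s : ℝ => (freeTraceComplex α a s).re) (Ioi p) :=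
    Complex.continuous_re.comp_continuousOn
      ((differentiableOn_freeTraceComplex hα hp ha).continuousOn.comp
        Complex.continuous_ofReal.continuousOn fun s hs => by simpa using hs)
  refine h1.congr fun s _ => ?_
  simp only [← ofReal_freeTrace, Complex.ofReal_re]

/-- Two free boundary responses agreeing on an interval agree from there on. -/
theorem freeTrace_eq_of_ae_eq {α α' p q A A' : ℝ} (hα : 0 < α) (hα' : 0 < α') (hp : 0 < p)
    (hpq : p < q) {a a' : ℕ → ℝ} (ha : ∀ n, |a n| ≤ A) (ha' : ∀ n, |a' n| ≤ A')
    (h : ∀ᵐ s : ℝ, s ∈ Ioo p q → freeTrace α a s = freeTrace α' a' s) {s : ℝ} (hs : p < s) :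
    freeTrace α a s = freeTrace α' a' s := by
  have hEq : EqOn (freeTrace α a) (freeTrace α' a') (Ioo p q) := by
    refine Measure.eqOn_open_of_ae_eq (μ := volume) ?_ isOpen_Ioo
      ((continuousOn_freeTrace hα hp ha).mono fun x hx => hx.1)
      ((continuousOn_freeTrace hα' hp ha').mono fun x hx => hx.1)
    rw [Filter.EventuallyEq, ae_restrict_iff' measurableSet_Ioo]
    exact h
  have hopen : IsOpen {z : ℂ | p < z.re} := isOpen_lt continuous_const Complex.continuous_re
  obtain ⟨m, hm⟩ := exists_between hpq
  -- Identity theorem on the connected half plane `Re z > p`, with agreement accumulating at the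
  -- real point `m`.
  have key : EqOn (freeTraceComplex α a) (freeTraceComplex α' a') {z : ℂ | p < z.re} := by
    refine AnalyticOnNhd.eqOn_of_preconnected_of_frequently_eq
      ((differentiableOn_freeTraceComplex hα hp ha).analyticOnNhd hopen)
      ((differentiableOn_freeTraceComplex hα' hp ha').analyticOnNhd hopen)
      (convex_halfSpace_re_gt p).isPreconnected (z₀ := (m : ℂ)) (by simpa using hm.1) ?_
    have ht : Filter.Tendsto (fun x : ℝ => (x : ℂ)) (nhdsWithin m {m}ᶜ)
        (nhdsWithin (m : ℂ) {(m : ℂ)}ᶜ) :=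
      Complex.continuous_ofReal.continuousWithinAt.tendsto_nhdsWithin
        fun x hx => by simpa using hx
    refine ht.frequently (Filter.Eventually.frequently ?_)
    filter_upwards [mem_nhdsWithin_of_mem_nhds (Ioo_mem_nhds hm.1 hm.2)] with x hx
    rw [← ofReal_freeTrace, ← ofReal_freeTrace, hEq hx]
  have := key (show (s : ℂ) ∈ {z : ℂ | p < z.re} by simpa using hs)
  rw [← ofReal_freeTrace, ← ofReal_freeTrace] at this
  exact_mod_cast this

/-- A free boundary response that vanishes eventually has vanishing initial cosine moments. -/
theorem eq_zero_of_freeTrace_eq_zero {α p A : ℝ} (hα : 0 < α) (hp : 0 < p) {a : ℕ → ℝ}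
    (ha : ∀ n, |a n| ≤ A) (h : ∀ s, p < s → freeTrace α a s = 0) (m : ℕ) : a m = 0 := by
  induction m using Nat.strong_induction_on with
  | _ m ih =>
  set c : ℕ → ℝ := fun n => α * (n * Real.pi) ^ 2 with hc
  have hpi := Real.pi_pos
  have hcm : ∀ n, m < n → c m < c n := fun n hn => by
    have : (m : ℝ) < n := by exact_mod_cast hn
    simp only [hc]; gcongr
  -- Multiply the series by `e^{c m · s}` and let `s → ∞`: lower terms vanish by induction and
  -- higher ones decay, leaving the `m`-th coefficient. The value of the terms at `s = p + 1`
  -- dominates.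
  have hT : Filter.Tendsto (fun s : ℝ => ∑' n, cosWeight n * a n * Real.exp (-(c n - c m) * s))
      Filter.atTop (nhds (∑' n, if n = m then cosWeight m * a m else 0)) := by
    refine tendsto_tsum_of_dominated_convergence
      (bound := fun n => Real.exp (c m * (p + 1)) *
        |cosWeight n * a n * Real.exp (-(α * (n * Real.pi) ^ 2) * (p + 1))|) ?_ ?_ ?_
    · refine Summable.mul_left _ (Summable.of_nonneg_of_le (fun n => abs_nonneg _)
        (fun n => ?_) (summable_exp_pow (A := A) hα hp))
      exact abs_freeTrace_term_le hα hp (by linarith) ha n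
    · intro n
      rcases lt_trichotomy n m with hn | hn | hn
      · simp [ih n hn, hn.ne]
      · subst hn; simp
      · rw [if_neg hn.ne']
        have h1 : Filter.Tendsto (fun s : ℝ => Real.exp (-(c n - c m) * s))
            Filter.atTop (nhds 0) :=
          Real.tendsto_exp_atBot.comp
            (Filter.tendsto_id.const_mul_atTop_of_neg (by linarith [hcm n hn]))
        simpa using h1.const_mul (cosWeight n * a n)
    · filter_upwards [Filter.eventually_ge_atTop (p + 1)] with s hs n
      rcases lt_or_ge n m with hn | hn
      · simp [ih n hn]
      · have hle : c m ≤ c n := by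
          rcases hn.eq_or_lt with h | h
          · rw [h]
          · exact (hcm n h).le
        rw [norm_mul, Real.norm_eq_abs, Real.norm_eq_abs, Real.abs_exp, abs_mul _ (Real.exp _),
          Real.abs_exp, mul_left_comm, ← Real.exp_add]
        gcongr
        simp only [hc] at hle ⊢
        nlinarith
  rw [tsum_ite_eq] at hT
  have hz : Filter.Tendsto (fun s : ℝ => ∑' n, cosWeight n * a n * Real.exp (-(c n - c m) * s))
      Filter.atTop (nhds 0) := by
    refine tendsto_const_nhds.congr' ?_
    filter_upwards [Filter.eventually_gt_atTop p] with s hs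
    have e : ∀ n, cosWeight n * a n * Real.exp (-(c n - c m) * s)
        = Real.exp (c m * s) * (cosWeight n * a n * Real.exp (-(α * (n * Real.pi) ^ 2) * s)) := by
      intro n
      rw [mul_left_comm, ← Real.exp_add]
      congr 2; simp only [hc]; ring
    simp_rw [e]
    rw [tsum_mul_left]
    have := h s hs
    rw [freeTrace] at this
    rw [this, mul_zero]
  have := tendsto_nhds_unique hT hz
  exact (mul_eq_zero.1 this).resolve_left (cosWeight_pos m).ne'

/-- The series need not converge at `s = 0` for merely bounded moments; termwise integration is
justified because `g` vanishes up to `p > 0`. -/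
theorem hasSum_integral_freeTrace_mul {α p A : ℝ} (hα : 0 < α) (hp : 0 < p) {a : ℕ → ℝ}
    (ha : ∀ n, |a n| ≤ A) {g : ℝ → ℝ} (hg : Continuous g) (hgs : HasCompactSupport g)
    (hgp : ∀ s, s ≤ p → g s = 0) :
    HasSum (fun n : ℕ => cosWeight n * (a n * backwardSol (α * (n * Real.pi) ^ 2) g 0))
      (∫ s in Ioi (0 : ℝ), freeTrace α a s * g s) := by
  have hA : 0 ≤ A := (abs_nonneg _).trans (ha 0)
  have e : ∀ n : ℕ, cosWeight n * (a n * backwardSol (α * (n * Real.pi) ^ 2) g 0)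
      = ∫ s in Ioi (0 : ℝ), cosWeight n * a n * Real.exp (-(α * (n * Real.pi) ^ 2) * s) * g s := by
    intro n
    rw [backwardSol, ← integral_const_mul, ← integral_const_mul]
    simp only [sub_zero, mul_assoc]
  simp_rw [e]
  have hgi : IntegrableOn g (Ioi 0) := (hg.integrable_of_hasCompactSupport hgs).integrableOn
  have hbd : ∀ (n : ℕ) (s : ℝ),
      ‖cosWeight n * a n * Real.exp (-(α * (n * Real.pi) ^ 2) * s) * g s‖
        ≤ 2 * A * Real.exp (-(α * Real.pi ^ 2 * p)) ^ n * |g s| := by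
    intro n s
    rcases le_or_gt s p with hs | hs
    · simp [hgp s hs]
    · rw [norm_mul, Real.norm_eq_abs, Real.norm_eq_abs]
      gcongr
      exact abs_freeTrace_term_le hα hp hs.le ha n
  have hsum : ∀ s, Summable fun n : ℕ =>
      2 * A * Real.exp (-(α * Real.pi ^ 2 * p)) ^ n * |g s| := fun s =>
    (summable_exp_pow hα hp).mul_right _
  refine hasSum_integral_of_dominated_convergence _
    (fun n => Continuous.aestronglyMeasurable (by fun_prop))
    (fun n => Filter.Eventually.of_forall (hbd n))
    (Filter.Eventually.of_forall hsum) ?_ (Filter.Eventually.of_forall fun s => ?_)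
  · simp_rw [tsum_mul_right]
    exact hgi.abs.const_mul _
  · rcases le_or_gt s p with hs | hs
    · simp [hgp s hs, hasSum_zero]
    · have h1 : Summable fun n : ℕ =>
          cosWeight n * a n * Real.exp (-(α * (n * Real.pi) ^ 2) * s) :=
        Summable.of_norm_bounded (summable_exp_pow (A := A) hα hp)
          (fun n => abs_freeTrace_term_le hα hp hs.le ha n)
      exact h1.hasSum.mul_right _

/-! ### Free and forced parts of the observation -/

/-- For the pure exponential `e^{-zs}` the backward solution is exactly `e^{-zt}/(z + c)`. The
truncation alters the datum only after `b`, by at most `e^{-zb}`. -/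
theorem abs_backwardSol_sub_exp_le {c z b t : ℝ} (hc : 0 < c) (hz : 0 < z) {g : ℝ → ℝ}
    (hg : Continuous g) (h1 : ∀ s, t < s → s ≤ b → g s = Real.exp (-z * s))
    (h2 : ∀ s, b < s → 0 ≤ g s ∧ g s ≤ Real.exp (-z * s)) :
    |backwardSol c g t - Real.exp (-z * t) / (z + c)| ≤ Real.exp (-z * b) / c := by
  have hbd : ∀ s, t < s → |g s - Real.exp (-z * s)| ≤ Real.exp (-z * b) := by
    intro s hs
    rcases le_or_gt s b with hsb | hsb
    · rw [h1 s hs hsb, sub_self, abs_zero]; exact (Real.exp_pos _).le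
    · obtain ⟨h3, h4⟩ := h2 s hsb
      have h5 : Real.exp (-z * s) ≤ Real.exp (-z * b) := by
        rw [Real.exp_le_exp]; nlinarith
      rw [abs_le]; constructor <;> linarith [Real.exp_pos (-z * s)]
  have hE : ∀ s, Real.exp (-c * (s - t)) * Real.exp (-z * s)
      = Real.exp (-z * t) * Real.exp (-(z + c) * (s - t)) := by
    intro s
    rw [← Real.exp_add, ← Real.exp_add]; congr 1; ring
  have i1 : IntegrableOn (fun s => Real.exp (-c * (s - t)) * Real.exp (-z * s)) (Ioi t) := by
    simp_rw [hE]
    exact (integrableOn_exp_neg_mul_sub (by linarith) t).const_mul _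
  have i2 : IntegrableOn (fun s => Real.exp (-c * (s - t)) * (g s - Real.exp (-z * s)))
      (Ioi t) := by
    refine Integrable.mul_bdd (c := Real.exp (-z * b)) (integrableOn_exp_neg_mul_sub hc t)
      (Continuous.aestronglyMeasurable (by fun_prop)) ?_
    filter_upwards [ae_restrict_mem measurableSet_Ioi] with s hs using hbd s hs
  have e : backwardSol c g t - Real.exp (-z * t) / (z + c)
      = ∫ s in Ioi t, Real.exp (-c * (s - t)) * (g s - Real.exp (-z * s)) := by
    have e1 : ∫ s in Ioi t, Real.exp (-c * (s - t)) * Real.exp (-z * s)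
        = Real.exp (-z * t) / (z + c) := by
      simp_rw [hE]
      rw [integral_const_mul, integral_exp_neg_mul_sub (by linarith)]; ring
    rw [← e1, sub_eq_iff_eq_add, ← integral_add i2 i1, backwardSol]
    congr 1; ext s; ring
  rw [e]
  exact abs_setIntegral_exp_mul_le hc hbd

theorem integral_trace_mul_congr {y y' g : ℝ → ℝ} {p e : ℝ}
    (hy : ∀ᵐ t : ℝ, t ∈ Ioo p e → y t = y' t) (hg : ∀ t, t ∉ Ioo p e → g t = 0) :
    ∫ t in Ioi (0 : ℝ), y t * g t = ∫ t in Ioi (0 : ℝ), y' t * g t := by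
  refine integral_congr_ae (ae_restrict_of_ae ?_)
  filter_upwards [hy] with t ht
  by_cases h : t ∈ Ioo p e
  · rw [ht h]
  · rw [hg t h, mul_zero, mul_zero]

/-- While the control is inactive the observation is the free response, so two solutions with the
same observation have the same free response. -/
theorem IsHeatSolution.freeTrace_eq {T₁ T₂ α α' : ℝ} (hT₁ : 0 < T₁) (hT₁₂ : T₁ < T₂)
    {f : ℝ → ℝ} (hf : LocallyIntegrableOn f (Ici 0)) (hf_zero : ∀ t ∈ Ico (0 : ℝ) T₂, f t = 0)
    (hα : 0 < α) (hα' : 0 < α') {u₀ u₀' : ℝ → ℝ} (hu₀ : IntegrableOn u₀ (Ioo 0 1))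
    (hu₀' : IntegrableOn u₀' (Ioo 0 1)) {u u' : ℝ → ℝ → ℝ}
    (hu : IsHeatSolution α f u₀ u) (hu' : IsHeatSolution α' f u₀' u')
    (hy : ∀ᵐ t : ℝ, t ∈ Ioo T₁ T₂ → u 0 t = u' 0 t) {s : ℝ} (hs : T₁ < s) :
    freeTrace α (cosMoment u₀) s = freeTrace α' (cosMoment u₀') s := by
  have key : ∀ {β : ℝ} (_ : 0 < β) {w₀ : ℝ → ℝ} (_ : IntegrableOn w₀ (Ioo 0 1)) {w : ℝ → ℝ → ℝ}
      (_ : IsHeatSolution β f w₀ w) {g : ℝ → ℝ} (_ : ContDiff ℝ ∞ g) (_ : HasCompactSupport g)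
      (_ : ∀ t, t ∉ Ioo T₁ T₂ → g t = 0),
      ∫ t in Ioi (0 : ℝ), w 0 t * g t
        = ∫ t in Ioi (0 : ℝ), freeTrace β (cosMoment w₀) t * g t := by
    intro β hβ w₀ hw₀ w hw g hg hgs hgz
    have h1 := hw.hasSum_integral_trace_mul hβ hw₀ hf hg hgs
    have h2 := hasSum_integral_freeTrace_mul hβ hT₁ (abs_cosMoment_le hw₀) hg.continuous hgs
      (fun s hs => hgz s fun h => by linarith [h.1])
    -- The control vanishes before `T₂`, and the backward solution vanishes from `T₂` on because `g`
    -- does.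
    have h3 : ∀ n : ℕ, ∫ t in Ioi (0 : ℝ), f t * backwardSol (β * (n * Real.pi) ^ 2) g t = 0 := by
      intro n
      refine setIntegral_eq_zero_of_forall_eq_zero fun t ht => ?_
      rcases lt_or_ge t T₂ with h | h
      · rw [hf_zero t ⟨le_of_lt ht, h⟩, zero_mul]
      · rw [backwardSol_eq_zero (fun s hs => hgz s fun hm => by linarith [hm.2]) h, mul_zero]
    simp_rw [h3, sub_zero] at h1
    exact h1.unique h2
  refine freeTrace_eq_of_ae_eq hα hα' hT₁ hT₁₂ (abs_cosMoment_le hu₀) (abs_cosMoment_le hu₀') ?_ hs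
  have hc := (continuousOn_freeTrace hα hT₁ (abs_cosMoment_le hu₀)).mono
    (fun t (ht : t ∈ Ioo T₁ T₂) => ht.1)
  have hc' := (continuousOn_freeTrace hα' hT₁ (abs_cosMoment_le hu₀')).mono
    (fun t (ht : t ∈ Ioo T₁ T₂) => ht.1)
  have hD : ∀ᵐ t : ℝ, t ∈ Ioo T₁ T₂ →
      freeTrace α (cosMoment u₀) t - freeTrace α' (cosMoment u₀') t = 0 := by
    refine isOpen_Ioo.ae_eq_zero_of_integral_contDiff_smul_eq_zero
      ((hc.sub hc').locallyIntegrableOn measurableSet_Ioo) fun g hg hgs hgt => ?_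
    have hgz : ∀ t, t ∉ Ioo T₁ T₂ → g t = 0 := fun t ht =>
      image_eq_zero_of_notMem_tsupport fun hm => ht (hgt hm)
    have hint : ∀ {D : ℝ → ℝ}, ContinuousOn D (Ioo T₁ T₂) → Integrable fun t => D t * g t := by
      intro D hDc
      have h1 : IntegrableOn (fun t => D t * g t) (tsupport g) :=
        ((hDc.mono hgt).mul hg.continuous.continuousOn).integrableOn_compact hgs
      rwa [integrableOn_iff_integrable_of_support_subset] at h1
      exact (Function.support_mul_subset_right _ _).trans (subset_tsupport g)
    have hset : ∀ D : ℝ → ℝ, ∫ t in Ioi (0 : ℝ), D t * g t = ∫ t, D t * g t := fun D =>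
      setIntegral_eq_integral_of_forall_compl_eq_zero fun t ht => by
        rw [hgz t fun hm => ht (hT₁.trans hm.1), mul_zero]
    calc ∫ t, g t • (freeTrace α (cosMoment u₀) t - freeTrace α' (cosMoment u₀') t)
        = ∫ t, (freeTrace α (cosMoment u₀) t * g t - freeTrace α' (cosMoment u₀') t * g t) := by
          congr 1; ext t; rw [smul_eq_mul]; ring
      _ = 0 := by
          rw [integral_sub (hint hc) (hint hc'), ← hset, ← hset, ← key hα hu₀ hu hg hgs hgz,
            ← key hα' hu₀' hu' hg hgs hgz, integral_trace_mul_congr hy hgz, sub_self]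
  filter_upwards [hD] with t ht htm using sub_eq_zero.1 (ht htm)

/-- A smooth cutoff equal to `1` on `[T₂,b]` and supported in `[p,e]`. -/
theorem exists_intervalCutoff {p T₂ b e : ℝ} (hp : p < T₂) (hb : b < e) :
    ∃ χ : ℝ → ℝ, ContDiff ℝ ∞ χ ∧ (∀ s ∈ Icc T₂ b, χ s = 1) ∧ (∀ s, s ≤ p → χ s = 0) ∧
      (∀ s, e ≤ s → χ s = 0) ∧ ∀ s, 0 ≤ χ s ∧ χ s ≤ 1 := by
  refine ⟨fun s => Real.smoothTransition ((s - p) / (T₂ - p))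
    * Real.smoothTransition ((e - s) / (e - b)), ?_, ?_, ?_, ?_, ?_⟩
  · refine ContDiff.mul ?_ ?_
    · exact Real.smoothTransition.contDiff.comp ((contDiff_id.sub contDiff_const).div_const _)
    · exact Real.smoothTransition.contDiff.comp ((contDiff_const.sub contDiff_id).div_const _)
  · intro s hs
    beta_reduce
    rw [Real.smoothTransition.one_of_one_le, Real.smoothTransition.one_of_one_le, one_mul]
    · rw [le_div_iff₀ (by linarith)]; linarith [hs.2]
    · rw [le_div_iff₀ (by linarith)]; linarith [hs.1]
  · intro s hs
    beta_reduce
    rw [Real.smoothTransition.zero_of_nonpos, zero_mul]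
    exact div_nonpos_of_nonpos_of_nonneg (by linarith) (by linarith)
  · intro s hs
    beta_reduce
    rw [Real.smoothTransition.zero_of_nonpos (x := (e - s) / (e - b)), mul_zero]
    exact div_nonpos_of_nonpos_of_nonneg (by linarith) (by linarith)
  · intro s
    exact ⟨mul_nonneg (Real.smoothTransition.nonneg _) (Real.smoothTransition.nonneg _),
      mul_le_one₀ (Real.smoothTransition.le_one _) (Real.smoothTransition.nonneg _)
        (Real.smoothTransition.le_one _)⟩

/-- The forced response tested against a cut-off exponential is a truncated Laplace transform of
the control, up to an exponentially smaller remainder. -/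
theorem abs_integral_mul_backwardSol_sub_le {T₂ b e c z : ℝ} (hT₂ : 0 < T₂) (hTb : T₂ < b)
    (hbe : b < e) (hc : 0 < c) (hz : 0 < z) {f : ℝ → ℝ} (hf : LocallyIntegrableOn f (Ici 0))
    (hf_zero : ∀ t ∈ Ico (0 : ℝ) T₂, f t = 0) {χ : ℝ → ℝ} (hχ : Continuous χ)
    (hχ1 : ∀ s ∈ Icc T₂ b, χ s = 1) (hχe : ∀ s, e ≤ s → χ s = 0)
    (hχ01 : ∀ s, 0 ≤ χ s ∧ χ s ≤ 1) :
    |(∫ t in Ioi (0 : ℝ), f t * backwardSol c (fun s => Real.exp (-z * s) * χ s) t)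
      - 1 / (z + c) * ∫ t in Ioo T₂ b, f t * Real.exp (-z * t)|
      ≤ Real.exp (-z * b) / c * ∫ t in Ioo (0 : ℝ) e, |f t| := by
  set g : ℝ → ℝ := fun s => Real.exp (-z * s) * χ s with hg
  have hgc : Continuous g := by fun_prop
  have hg0 : ∀ s, 0 ≤ g s ∧ g s ≤ Real.exp (-z * s) := fun s =>
    ⟨mul_nonneg (Real.exp_pos _).le (hχ01 s).1,
      mul_le_of_le_one_right (Real.exp_pos _).le (hχ01 s).2⟩
  have hge : ∀ s, e ≤ s → g s = 0 := fun s hs => by simp [hg, hχe s hs]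
  have hg1 : ∀ s ∈ Icc T₂ b, g s = Real.exp (-z * s) := fun s hs => by simp [hg, hχ1 s hs]
  have hJc : Continuous (backwardSol c g) :=
    continuous_iff_continuousAt.2 fun t => (hasDerivAt_backwardSol hgc hge t).continuousAt
  set G : ℝ → ℝ := (Ico T₂ b).indicator fun t => Real.exp (-z * t) / (z + c) with hG
  -- Dropping `t < T₂` is harmless since `f = 0` there, and necessary since `g` is the exponential
  -- only from `T₂` on. Past `b` the comparison function `G` is zero and the backward solution
  -- itself is within the error.
  set k : ℝ → ℝ := fun t => (Ici T₂).indicator (fun t => backwardSol c g t - G t) t with hk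
  have hfe : IntegrableOn f (Icc 0 e) :=
    hf.integrableOn_compact_subset Icc_subset_Ici_self isCompact_Icc
  have hJ0 : ∀ t, e ≤ t → backwardSol c g t = 0 := fun t ht => backwardSol_eq_zero hge ht
  have i1 : IntegrableOn (fun t => f t * backwardSol c g t) (Ioi 0) := by
    refine IntegrableOn.of_forall_sdiff_eq_zero (s := Icc 0 e) ?_ measurableSet_Ioi fun t ht => ?_
    · exact hfe.mul_continuousOn hJc.continuousOn isCompact_Icc
    · rw [hJ0 t, mul_zero]
      by_contra h
      exact ht.2 ⟨le_of_lt ht.1, (not_le.1 h).le⟩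
  have i2 : IntegrableOn (fun t => f t * G t) (Ioi 0) := by
    have e1 : (fun t => f t * G t)
        = (Ico T₂ b).indicator fun t => f t * (Real.exp (-z * t) / (z + c)) := by
      ext t; simp only [hG]; by_cases h : t ∈ Ico T₂ b <;> simp [h]
    rw [e1]
    refine (IntegrableOn.integrable_indicator ?_ measurableSet_Ico).integrableOn
    refine IntegrableOn.mono_set (t := Icc 0 e) ?_
      fun t ht => ⟨by linarith [ht.1], by linarith [ht.2]⟩
    exact hfe.mul_continuousOn (Continuous.continuousOn (by fun_prop)) isCompact_Icc
  have e2 : 1 / (z + c) * ∫ t in Ioo T₂ b, f t * Real.exp (-z * t)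
      = ∫ t in Ioi (0 : ℝ), f t * G t := by
    have e1 : (fun t => f t * G t)
        = (Ico T₂ b).indicator fun t => 1 / (z + c) * (f t * Real.exp (-z * t)) := by
      ext t; simp only [hG]; by_cases h : t ∈ Ico T₂ b <;> simp [h]; ring
    rw [e1, setIntegral_indicator measurableSet_Ico, ← integral_const_mul,
      inter_eq_self_of_subset_right (show Ico T₂ b ⊆ Ioi 0 from fun t ht => hT₂.trans_le ht.1),
      integral_Ico_eq_integral_Ioo]
  rw [e2, ← integral_sub i1 i2]
  have e3 : ∫ t in Ioi (0 : ℝ), (f t * backwardSol c g t - f t * G t)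
      = ∫ t in Ioi (0 : ℝ), f t * k t := by
    refine setIntegral_congr_fun measurableSet_Ioi fun t ht => ?_
    simp only [hk]
    rcases lt_or_ge t T₂ with h | h
    · rw [hf_zero t ⟨le_of_lt ht, h⟩]; ring
    · rw [indicator_of_mem (mem_Ici.2 h)]; ring
  rw [e3]
  refine abs_setIntegral_mul_le hf (fun t _ => ?_) fun t ht => ?_
  · simp only [hk]
    have hpos : 0 ≤ Real.exp (-z * b) / c := by positivity
    rcases lt_or_ge t T₂ with h | h
    · rw [indicator_of_notMem (by simpa using h), abs_zero]; exact hpos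
    rw [indicator_of_mem (mem_Ici.2 h)]
    rcases lt_or_ge t b with htb | htb
    · have hmoment := abs_backwardSol_sub_exp_le (t := t) (b := b) hc hz hgc
        (fun s h1 h2 => hg1 s ⟨by linarith, h2⟩) (fun s _ => hg0 s)
      simp only [hG]; rwa [indicator_of_mem (show t ∈ Ico T₂ b from ⟨h, htb⟩)]
    · simp only [hG]
      rw [indicator_of_notMem (fun hm => by linarith [hm.2]), sub_zero]
      refine abs_backwardSol_le hc fun s hs => ?_
      rw [abs_of_nonneg (hg0 s).1]
      refine (hg0 s).2.trans ?_
      rw [Real.exp_le_exp]; nlinarith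
  · simp only [hk, hG]
    rw [indicator_of_mem (mem_Ici.2 (by linarith)),
      indicator_of_notMem (fun hm => by linarith [hm.2]), hJ0 t ht, sub_zero]

/-! ### Comparison of two diffusivities -/

/-- If two solutions have the same observation but the first diffusivity is strictly smaller, the
control has exponential moments of quadratic growth right after its switching time. -/
theorem IsHeatSolution.abs_exp_moment_le {T₁ T₂ b e α α' : ℝ} (hT₁ : 0 < T₁) (hT₁₂ : T₁ < T₂)
    (hTb : T₂ < b) (hbe : b < e)
    {f : ℝ → ℝ} (hf : LocallyIntegrableOn f (Ici 0)) (hf_zero : ∀ t ∈ Ico (0 : ℝ) T₂, f t = 0)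
    (hα : 0 < α) (hαα' : α < α') {u₀ u₀' : ℝ → ℝ} (hu₀ : IntegrableOn u₀ (Ioo 0 1))
    (hu₀' : IntegrableOn u₀' (Ioo 0 1)) {u u' : ℝ → ℝ → ℝ}
    (hu : IsHeatSolution α f u₀ u) (hu' : IsHeatSolution α' f u₀' u')
    (hy : ∀ᵐ t : ℝ, t ∈ Ioo T₁ e → u 0 t = u' 0 t) :
    ∃ C : ℝ, ∀ z : ℝ, 1 ≤ z →
      |∫ t in Ioo T₂ b, f t * Real.exp (z * (b - t))| ≤ C * (1 + z) ^ 2 := by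
  have hα' : 0 < α' := hα.trans hαα'
  have hpi := Real.pi_pos
  have hT₂ : 0 < T₂ := hT₁.trans hT₁₂
  set c : ℕ → ℝ := fun n => α * (n * Real.pi) ^ 2 with hc
  set c' : ℕ → ℝ := fun n => α' * (n * Real.pi) ^ 2 with hc'
  have hcpos : ∀ n : ℕ, n ≠ 0 → 0 < c n := fun n hn => by
    have : 0 < (n : ℝ) := by positivity
    simp only [hc]; positivity
  have hcc' : ∀ n, c n ≤ c' n := fun n => by simp only [hc, hc']; gcongr
  set Q := ∫ t in Ioo (0 : ℝ) e, |f t|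
  have hQ0 : 0 ≤ Q := integral_nonneg fun t => abs_nonneg _
  obtain ⟨p, hp⟩ := exists_between hT₁₂
  obtain ⟨χ, hχ, hχ1, hχp, hχe, hχ01⟩ := exists_intervalCutoff hp.2 hbe
  -- The term `n = 0` is `0` by the convention `1 / 0 = 0`. This is consistent with the bound below,
  -- since `c 0 = c' 0 = 0` makes the remainder `ρ 0` vanish.
  have hbound : Summable fun n : ℕ => 2 * (1 / c n + 1 / c' n) := by
    have h1 := ((Real.summable_one_div_nat_pow.2 one_lt_two).mul_left
      (2 * (1 / (α * Real.pi ^ 2) + 1 / (α' * Real.pi ^ 2))))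
    refine h1.congr fun n => ?_
    simp only [hc, hc', mul_pow, one_div, mul_inv]; ring
  set S := ∑' n : ℕ, 2 * (1 / c n + 1 / c' n)
  refine ⟨Q * S / (2 * ((α' - α) * Real.pi ^ 2)) * ((1 + c 1) * (1 + c' 1)), fun z hz => ?_⟩
  have hz0 : 0 < z := by linarith
  set F := ∫ t in Ioo T₂ b, f t * Real.exp (-z * t) with hF
  set g : ℝ → ℝ := fun s => Real.exp (-z * s) * χ s with hg
  have hgd : ContDiff ℝ ∞ g :=
    (Real.contDiff_exp.comp (contDiff_const.mul contDiff_id)).mul hχ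
  have hgs : HasCompactSupport g := by
    refine HasCompactSupport.of_support_subset_isCompact (isCompact_Icc (a := p) (b := e)) ?_
    intro t ht
    rw [Function.mem_support] at ht
    constructor
    · by_contra h
      exact ht (by simp [hg, hχp t (not_le.1 h).le])
    · by_contra h
      exact ht (by simp [hg, hχe t (not_le.1 h).le])
  have hgp : ∀ s, s ≤ p → g s = 0 := fun s hs => by simp [hg, hχp s hs]
  have hgz : ∀ t, t ∉ Ioo T₁ e → g t = 0 := fun t ht => by
    rw [mem_Ioo, not_and_or, not_lt, not_lt] at ht
    rcases ht with h | h
    · exact hgp t (h.trans hp.1.le)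
    · simp [hg, hχe t h]
  set X : ℕ → ℝ := fun n => ∫ t in Ioi (0 : ℝ), f t * backwardSol (c n) g t with hX
  set X' : ℕ → ℝ := fun n => ∫ t in Ioi (0 : ℝ), f t * backwardSol (c' n) g t with hX'
  have hp0 : 0 < p := hT₁.trans hp.1
  -- the free responses cancel
  have hXsum : HasSum (fun n => cosWeight n * (X n - X' n)) 0 := by
    have h1 := hu.hasSum_integral_trace_mul hα hu₀ hf hgd hgs
    have h2 := hu'.hasSum_integral_trace_mul hα' hu₀' hf hgd hgs
    have h3 := hasSum_integral_freeTrace_mul hα hp0 (abs_cosMoment_le hu₀) hgd.continuous hgs hgp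
    have h4 := hasSum_integral_freeTrace_mul hα' hp0 (abs_cosMoment_le hu₀') hgd.continuous hgs hgp
    have h5 : ∫ s in Ioi (0 : ℝ), freeTrace α (cosMoment u₀) s * g s
        = ∫ s in Ioi (0 : ℝ), freeTrace α' (cosMoment u₀') s * g s := by
      congr 1; ext s
      rcases le_or_gt s p with hs | hs
      · rw [hgp s hs, mul_zero, mul_zero]
      · rw [IsHeatSolution.freeTrace_eq hT₁ hT₁₂ hf hf_zero hα hα' hu₀ hu₀' hu hu' ?_
          (hp.1.trans hs)]
        filter_upwards [hy] with t ht htm using ht ⟨htm.1, htm.2.trans (hTb.trans hbe)⟩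
    have h6 := (h3.sub h1).sub (h4.sub h2)
    rw [h5, integral_trace_mul_congr hy hgz, sub_self] at h6
    refine h6.congr_fun ?_ |> id
    intro n
    simp only [hX, hX', hc, hc']; ring
  set ρ : ℕ → ℝ := fun n => (X n - 1 / (z + c n) * F) - (X' n - 1 / (z + c' n) * F) with hρ
  have hρ_le : ∀ n, ‖cosWeight n * ρ n‖ ≤ Real.exp (-z * b) * Q * (2 * (1 / c n + 1 / c' n)) := by
    intro n
    rw [norm_mul, Real.norm_eq_abs, Real.norm_eq_abs, abs_of_nonneg (cosWeight_nonneg n)]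
    rcases eq_or_ne n 0 with hn | hn
    · subst hn
      have : ρ 0 = 0 := by simp [hρ, hX, hX', hc, hc']
      rw [this]; simp [hc, hc']
    · have h1 := abs_integral_mul_backwardSol_sub_le hT₂ hTb hbe (hcpos n hn) hz0 hf hf_zero
        hχ.continuous hχ1 hχe hχ01
      have h2 := abs_integral_mul_backwardSol_sub_le hT₂ hTb hbe
        ((hcpos n hn).trans_le (hcc' n)) hz0 hf hf_zero hχ.continuous hχ1 hχe hχ01
      have h3 : |ρ n| ≤ Real.exp (-z * b) / c n * Q + Real.exp (-z * b) / c' n * Q :=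
        (abs_sub _ _).trans (add_le_add h1 h2)
      calc cosWeight n * |ρ n|
          ≤ 2 * (Real.exp (-z * b) / c n * Q + Real.exp (-z * b) / c' n * Q) :=
            mul_le_mul (cosWeight_le_two n) h3 (abs_nonneg _) zero_le_two
        _ = _ := by ring
  have hρs : Summable fun n => cosWeight n * ρ n :=
    Summable.of_norm_bounded (hbound.mul_left _) hρ_le
  have hρ_tsum : |∑' n, cosWeight n * ρ n| ≤ Real.exp (-z * b) * Q * S := by
    rw [← Real.norm_eq_abs]
    exact tsum_of_norm_bounded (hbound.hasSum.mul_left _) hρ_le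
  set κ : ℕ → ℝ := fun n => cosWeight n * (1 / (z + c n) - 1 / (z + c' n)) with hκ
  have hc0 : ∀ n, 0 ≤ c n := fun n => by simp only [hc]; positivity
  have hκ0 : ∀ n, 0 ≤ κ n := fun n => by
    refine mul_nonneg (cosWeight_nonneg n) (sub_nonneg.2 ?_)
    have := hcc' n
    have := hc0 n
    gcongr
  -- The extra factor `F` turns the terms into `F² κ n ≥ 0` regardless of the sign of `F`, so the
  -- sum bounds its single term `n = 1`.
  have hκF : HasSum (fun n => F * (F * κ n)) (F * (0 - ∑' n, cosWeight n * ρ n)) := by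
    refine HasSum.mul_left F ((hXsum.sub hρs.hasSum).congr_fun ?_ |> id)
    intro n
    simp only [hρ, hκ]; ring
  have h1 : F * (F * κ 1) ≤ F * (0 - ∑' n, cosWeight n * ρ n) :=
    le_hasSum hκF 1 fun n _ => by
      rw [← mul_assoc]; exact mul_nonneg (mul_self_nonneg F) (hκ0 n)
  have h2 : |F| * κ 1 ≤ Real.exp (-z * b) * Q * S := by
    rcases eq_or_ne F 0 with h0 | h0
    · rw [h0, abs_zero, zero_mul]; exact (abs_nonneg _).trans hρ_tsum
    · have hFpos : 0 < |F| := abs_pos.2 h0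
      refine le_of_mul_le_mul_left ?_ hFpos
      calc |F| * (|F| * κ 1) = F * (F * κ 1) := by
            rw [← mul_assoc, abs_mul_abs_self, mul_assoc]
        _ ≤ F * (0 - ∑' n, cosWeight n * ρ n) := h1
        _ ≤ |F| * |∑' n, cosWeight n * ρ n| := by
            rw [← abs_mul, zero_sub, mul_neg]; exact neg_le_abs _
        _ ≤ _ := by gcongr
  have hc1 := hcpos 1 one_ne_zero
  have hc1' := hc1.trans_le (hcc' 1)
  have hκ1 : κ 1 = 2 * ((α' - α) * Real.pi ^ 2) / ((z + c 1) * (z + c' 1)) := by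
    have e1 : c' 1 - c 1 = (α' - α) * Real.pi ^ 2 := by simp only [hc, hc']; push_cast; ring
    have h3 : z + c 1 ≠ 0 := by positivity
    have h4 : z + c' 1 ≠ 0 := by positivity
    simp only [hκ, cosWeight, one_ne_zero, if_false]
    rw [← e1]
    field_simp
    ring
  have hd : 0 < 2 * ((α' - α) * Real.pi ^ 2) := by
    have : 0 < α' - α := sub_pos.2 hαα'
    positivity
  have hmom : ∫ t in Ioo T₂ b, f t * Real.exp (z * (b - t)) = Real.exp (z * b) * F := by
    rw [hF, ← integral_const_mul]
    congr 1; ext t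
    rw [mul_left_comm, ← Real.exp_add]
    congr 2; ring
  rw [hmom, abs_mul, Real.abs_exp]
  rw [hκ1, ← mul_div_assoc, div_le_iff₀ (by positivity)] at h2
  have hS0 : 0 ≤ S := tsum_nonneg fun n => by
    have := hc0 n
    have := this.trans (hcc' n)
    positivity
  have hexp : Real.exp (z * b) * Real.exp (-z * b) = 1 := by
    rw [← Real.exp_add]; simp
  have h5 : (z + c 1) * (z + c' 1) ≤ ((1 + c 1) * (1 + c' 1)) * (1 + z) ^ 2 := by
    have h6 : z + c 1 ≤ (1 + c 1) * (1 + z) := by nlinarith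
    have h7 : z + c' 1 ≤ (1 + c' 1) * (1 + z) := by nlinarith
    calc _ ≤ ((1 + c 1) * (1 + z)) * ((1 + c' 1) * (1 + z)) := by gcongr
      _ = _ := by ring
  calc Real.exp (z * b) * |F|
      = Real.exp (z * b) * (|F| * (2 * ((α' - α) * Real.pi ^ 2)))
          / (2 * ((α' - α) * Real.pi ^ 2)) := by rw [← mul_assoc, mul_div_cancel_right₀ _ hd.ne']
    _ ≤ Real.exp (z * b) * (Real.exp (-z * b) * Q * S * ((z + c 1) * (z + c' 1)))
          / (2 * ((α' - α) * Real.pi ^ 2)) := by gcongr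
    _ = Q * S / (2 * ((α' - α) * Real.pi ^ 2)) * ((z + c 1) * (z + c' 1)) := by
        linear_combination
          Q * S / (2 * ((α' - α) * Real.pi ^ 2)) * ((z + c 1) * (z + c' 1)) * hexp
    _ ≤ Q * S / (2 * ((α' - α) * Real.pi ^ 2)) * (((1 + c 1) * (1 + c' 1)) * (1 + z) ^ 2) := by
        gcongr
    _ = _ := by ring

/-- The moment bound would make `f` vanish a.e. on an interval of positive length where it is a.e.
nonzero. -/
theorem IsHeatSolution.not_lt_of_trace_eq {T₁ T₂ e α α' : ℝ} (hT₁ : 0 < T₁) (hT₁₂ : T₁ < T₂)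
    (hTe : T₂ < e)
    {f : ℝ → ℝ} (hf : LocallyIntegrableOn f (Ici 0)) (hf_zero : ∀ t ∈ Ico (0 : ℝ) T₂, f t = 0)
    (hf_ne : ∀ᵐ t : ℝ, t ∈ Ioo T₂ e → f t ≠ 0)
    (hα : 0 < α) {u₀ u₀' : ℝ → ℝ} (hu₀ : IntegrableOn u₀ (Ioo 0 1))
    (hu₀' : IntegrableOn u₀' (Ioo 0 1)) {u u' : ℝ → ℝ → ℝ}
    (hu : IsHeatSolution α f u₀ u) (hu' : IsHeatSolution α' f u₀' u')
    (hy : ∀ᵐ t : ℝ, t ∈ Ioo T₁ e → u 0 t = u' 0 t) : ¬ α < α' := by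
  intro hlt
  obtain ⟨b, hTb, hbe⟩ := exists_between hTe
  obtain ⟨C, hC⟩ := IsHeatSolution.abs_exp_moment_le hT₁ hT₁₂ hTb hbe hf hf_zero hα hlt hu₀ hu₀'
    hu hu' hy
  have hfi : IntegrableOn f (Ioo T₂ b) :=
    (hf.integrableOn_compact_subset Icc_subset_Ici_self (isCompact_Icc (b := b))).mono_set
      fun t ht => ⟨by linarith [ht.1], ht.2.le⟩
  have h0 := ae_eq_zero_of_exp_moment_le hfi hC
  have hfalse : ∀ᵐ t : ℝ, t ∉ Ioo T₂ b := by
    filter_upwards [h0, hf_ne] with t h1 h2 hm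
    exact h2 ⟨hm.1, hm.2.trans hbe⟩ (h1 hm)
  have hvol : volume (Ioo T₂ b) = 0 := measure_eq_zero_iff_ae_notMem.2 hfalse
  rw [Real.volume_Ioo, ENNReal.ofReal_eq_zero] at hvol
  linarith

/-! ### Identification of the diffusivity and the initial state -/

theorem StateSpace.integrableOn (w : StateSpace) : IntegrableOn w (Ioo 0 1) :=
  (Lp.memLp w).integrable one_le_two

theorem mainTheorem1 (T₁ T₂ : ℝ) (T₃ : EReal)
    (hT₁ : 0 ≤ T₁) (hT₁₂ : T₁ < T₂) (hT₂₃ : (T₂ : EReal) < T₃)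
    (f : ℝ → ℝ) (hf : LocallyIntegrableOn f (Ici 0))
    (hf_zero : ∀ t ∈ Ico (0 : ℝ) T₂, f t = 0)
    (hf_ne : ∀ᵐ t : ℝ, T₂ ≤ t → (t : EReal) ≤ T₃ → f t ≠ 0)
    (α α' : ℝ) (hα : 0 < α) (hα' : 0 < α')
    (u₀ u₀' : StateSpace) (u u' : ℝ → ℝ → ℝ)
    (hu : IsHeatSolution α f u₀ u) (hu' : IsHeatSolution α' f u₀' u')
    (hy : ∀ᵐ t : ℝ, T₁ ≤ t → (t : EReal) ≤ T₃ → u 0 t = u' 0 t) :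
    α = α' ∧ u₀ = u₀' := by
  obtain ⟨e, hTe, heT⟩ := EReal.lt_iff_exists_real_btwn.1 hT₂₃
  have hTe : T₂ < e := EReal.coe_lt_coe_iff.1 hTe
  have hle : ∀ t : ℝ, t < e → (t : EReal) ≤ T₃ := fun t ht =>
    (EReal.coe_le_coe_iff.2 ht.le).trans heT.le
  -- `T₁` may be `0`, where the free response need not converge; observing only after `p > 0` avoids
  -- this.
  obtain ⟨p, hp⟩ := exists_between hT₁₂
  have hp0 : 0 < p := hT₁.trans_lt hp.1
  have hf_ne' : ∀ᵐ t : ℝ, t ∈ Ioo T₂ e → f t ≠ 0 := by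
    filter_upwards [hf_ne] with t ht hm using ht hm.1.le (hle t hm.2)
  have hy' : ∀ᵐ t : ℝ, t ∈ Ioo p e → u 0 t = u' 0 t := by
    filter_upwards [hy] with t ht hm using ht (hp.1.trans hm.1).le (hle t hm.2)
  have hu₀ := StateSpace.integrableOn u₀
  have hu₀' := StateSpace.integrableOn u₀'
  have hαα' : α = α' := le_antisymm
    (not_lt.1 (hu'.not_lt_of_trace_eq hp0 hp.2 hTe hf hf_zero hf_ne' hα' hu₀' hu₀ hu
      (hy'.mono fun t ht hm => (ht hm).symm)))
    (not_lt.1 (hu.not_lt_of_trace_eq hp0 hp.2 hTe hf hf_zero hf_ne' hα hu₀ hu₀' hu' hy'))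
  refine ⟨hαα', ?_⟩
  subst hαα'
  have hdiff : IntegrableOn (fun x => u₀ x - u₀' x) (Ioo 0 1) := hu₀.sub hu₀'
  have hmom : ∀ n, cosMoment (fun x => u₀ x - u₀' x) n = cosMoment u₀ n - cosMoment u₀' n := by
    intro n
    simp only [cosMoment, sub_mul]
    exact integral_sub (hu₀.mul_continuous_Ioo (by fun_prop))
      (hu₀'.mul_continuous_Ioo (by fun_prop))
  have hsummable : ∀ w : ℝ → ℝ, IntegrableOn w (Ioo 0 1) → ∀ s : ℝ, p < s →
      Summable fun n : ℕ =>
        cosWeight n * cosMoment w n * Real.exp (-(α * (n * Real.pi) ^ 2) * s) := by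
    intro w hw s hs
    exact Summable.of_norm_bounded
      (summable_exp_pow (A := ∫ x in Ioo (0 : ℝ) 1, |w x|) hα hp0)
      (fun n => abs_freeTrace_term_le hα hp0 hs.le (abs_cosMoment_le hw) n)
  -- With a common `α` the exponents coincide, so the difference of the free responses is the free
  -- response of `u₀ - u₀'`.
  have hfree : ∀ s, p < s → freeTrace α (cosMoment fun x => u₀ x - u₀' x) s = 0 := by
    intro s hs
    have h1 := hu.freeTrace_eq hp0 hp.2 hf hf_zero hα hα hu₀ hu₀' hu'
      (hy'.mono fun t ht hm => ht ⟨hm.1, hm.2.trans hTe⟩) hs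
    rw [← sub_eq_zero, freeTrace, freeTrace,
      ← (hsummable _ hu₀ s hs).tsum_sub (hsummable _ hu₀' s hs)]
      at h1
    refine Eq.trans ?_ h1
    rw [freeTrace]
    congr 1; ext n
    rw [hmom]; ring
  have hzero := ae_eq_zero_of_cosMoment_eq_zero hdiff
    (eq_zero_of_freeTrace_eq_zero hα hp0 (abs_cosMoment_le hdiff) hfree)
  refine Lp.ext ?_
  rw [Filter.EventuallyEq, ae_restrict_iff' measurableSet_Ioo]
  filter_upwards [hzero] with x hx hm using sub_eq_zero.1 (hx hm)
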